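/- **Conventions.** $L^2_+=L^2[0,\infty)$ (complex valued functions). A (finite) Blaschke product of degree $n=\deg(b)\ge 0$ is a function $b(s)=\rho\prod_{k=1}^n\frac{s+\overline{\alpha}_k}{s-\alpha_k}$ with $|\rho|=1$ and $\operatorname{Re}\alpha_k<0$; put $\widetilde b(s)=\overline{b(\overline s)}$, which is again a Blaschke product. There is a function $\theta\in L^1[0,\infty)$ with $b(s)=b(\infty)+\int_0^\infty e^{-st}\theta(t)\,dt$ for $\operatorname{Re}s>0$; the Wiener–Hopf operator $T_b$ on $L^2_+$ is $(T_bf)(t)=b(\infty)f(t)+\int_0^t\theta(t-\tau)f(\tau)\,d\tau$, and $\mathfrak H(b)=L^2_+\ominus T_bL^2_+$. If $T$ is an operator none of whose eigenvalues is a pole of $b$, then $b(T)$ is the value at $T$ of the rational function $b$. For a contraction $T$ on a finite dimensional Hilbert space, $D_T=(I-T^*T)^{1/2}$, $\mathfrak D_T$ is the range of $D_T$, and $\mathfrak d_T=\dim\mathfrak D_T$. A realization $\{A \text{ on }\mathcal X,B,C,D\}$ of a scalar function $\Theta$ (that is, $\Theta(s)=D+C(sI-A)^{-1}B$ for $\operatorname{Re}s>0$),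 with $\mathcal X$ a finite dimensional complex Hilbert space, is stable dissipative if all eigenvalues of $A$ have negative real part, $A+A^*+C^*C=0$, $D$ is unitary, and $B=-C^*D$. Its observability operator $\Gamma:\mathcal X\to L^2_+$ is $(\Gamma x)(t)=Ce^{At}x$. **Lemma 4.2.** Let $m$ and $\varphi$ be finite Blaschke products, let $\{A,B,C,D\}$ be a stable dissipative realization of $m$ with observability operator $\Gamma_m$, and let $Y=P_{\mathfrak H(\varphi)}|\mathfrak H(m):\mathfrak H(m)\to\mathfrak H(\varphi)$, where $P_{\mathfrak H(\varphi)}$ is the orthogonal projection of $L^2_+$ onto $\mathfrak H(\varphi)$. Then $Y$, $\varphi(-A)$ and $\widetilde\varphi(-A)$ are contractions, and the following hold. 1. There is a unitary operator $\Psi$ from the range of $Y$ onto $\mathfrak D_{\widetilde\varphi(-A)}$ such that $\Psi P_{\mathfrak H(\varphi)}\Gamma_m=D_{\widetilde\varphi(-A)}$ (in particular $P_{\mathfrak H(\varphi)}\Gamma_m$ maps $\mathcal X$ into the range of $Y$). Moreover, $$\mathfrak d_{\widetilde\varphi(-A)}=\mathfrak d_{\varphi(-A)}=\min\{\deg(\varphi),\deg(m)\}=\operatorname{rank}(Y).$$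 2. $\deg(\varphi)\le\deg(m)$ if and only if the range of $Y$ equals $\mathfrak H(\varphi)$. In this case $\mathfrak d_{\varphi(-A)}=\mathfrak d_{\widetilde\varphi(-A)}=\deg(\varphi)$ and $\dim\ker Y=\deg(m)-\deg(\varphi)$. 3. $Y$ is one to one if and only if $\deg(m)\le\deg(\varphi)$. In this case $\mathfrak d_{\varphi(-A)}=\mathfrak d_{\widetilde\varphi(-A)}=\deg(m)$ and $\dim\ker Y^*=\dim\,(\operatorname{im}Y)^\perp=\deg(\varphi)-\deg(m)$, where $(\operatorname{im}Y)^\perp$ is taken in $\mathfrak H(\varphi)$. 4. If $\deg(\varphi)<\deg(m)$, then $\mathfrak D_{\widetilde\varphi(-A)}^\perp\ne\{0\}$, and for every nonzero $x\in\mathfrak D_{\widetilde\varphi(-A)}^\perp$, $$\varphi(s)=\frac{C(sI-A)^{-1}x}{C(sI-A)^{-1}\widetilde\varphi(-A)x}$$ for every $s\in\mathbb C$ that is not an eigenvalue of $A$ and at which the denominator is not zero; the denominator vanishes at only finitely many such $s$. -/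

import Mathlib

open MeasureTheory Set Filter Topology
open scoped ENNReal NNReal Polynomial InnerProduct

/-- The space `L²[0, ∞)` of complex valued square integrable functions. -/
abbrev LTwoPlus : Type := Lp ℂ 2 (volume.restrict (Ioi (0 : ℝ)))

theorem lintegral_conv_sq_le (k g : ℝ → ℝ≥0∞) (hk : AEMeasurable k) (hg : AEMeasurable g) :
    ∫⁻ t, (∫⁻ τ, k (t - τ) * g τ) ^ 2 ≤ (∫⁻ t, k t) ^ 2 * ∫⁻ t, g t ^ 2 := by
  have hkm : ∀ t : ℝ, AEMeasurable (fun τ => k (t - τ)) := fun t =>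
    hk.comp_quasiMeasurePreserving (quasiMeasurePreserving_sub_left volume t)
  have hpt : ∀ t, (∫⁻ τ, k (t - τ) * g τ) ^ 2 ≤ (∫⁻ t, k t) * ∫⁻ τ, k (t - τ) * g τ ^ 2 := by
    intro t
    have h := ENNReal.lintegral_mul_le_Lp_mul_Lq volume Real.HolderConjugate.two_two
      (f := fun τ => k (t - τ) ^ (1 / 2 : ℝ)) (g := fun τ => k (t - τ) ^ (1 / 2 : ℝ) * g τ)
      ((hkm t).pow_const _) (((hkm t).pow_const _).mul hg)
    have e1 : ∀ x : ℝ≥0∞, (x ^ (1 / 2 : ℝ)) ^ (2 : ℝ) = x := fun x => by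
      rw [← ENNReal.rpow_mul]; norm_num
    have e2 : ∀ x : ℝ≥0∞, x ^ (1 / 2 : ℝ) * x ^ (1 / 2 : ℝ) = x := fun x => by
      rw [← ENNReal.rpow_add_of_nonneg _ _ (by norm_num) (by norm_num)]; norm_num
    simp only [Pi.mul_apply, ← mul_assoc, e2, e1, ENNReal.mul_rpow_of_nonneg _ _ (zero_le_two (α := ℝ)),
      ENNReal.rpow_two] at h
    calc _ ≤ _ := pow_le_pow_left' h 2
      _ = _ := by
        rw [mul_pow]
        simp only [← ENNReal.rpow_two, e1]
        rw [lintegral_sub_left_eq_self k t]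
  calc _ ≤ ∫⁻ t, (∫⁻ t, k t) * ∫⁻ τ, k (t - τ) * g τ ^ 2 := lintegral_mono hpt
    _ = (∫⁻ t, k t) * ∫⁻ t, ∫⁻ τ, k (t - τ) * g τ ^ 2 := by
        apply lintegral_const_mul''
        apply AEMeasurable.lintegral_prod_right'
          (f := fun p : ℝ × ℝ => k (p.1 - p.2) * g p.2 ^ 2)
        exact (hk.comp_quasiMeasurePreserving (quasiMeasurePreserving_sub volume volume)).mul
          ((hg.comp_quasiMeasurePreserving Measure.quasiMeasurePreserving_snd).pow_const 2)
    _ = (∫⁻ t, k t) * ∫⁻ τ, ∫⁻ t, k (t - τ) * g τ ^ 2 := by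
        rw [lintegral_lintegral_swap]
        exact (hk.comp_quasiMeasurePreserving (quasiMeasurePreserving_sub volume volume)).mul
          ((hg.comp_quasiMeasurePreserving Measure.quasiMeasurePreserving_snd).pow_const 2)
    _ = _ := by
        have : ∀ τ, ∫⁻ t, k (t - τ) * g τ ^ 2 = (∫⁻ t, k t) * g τ ^ 2 := fun τ => by
          have hm : AEMeasurable (fun t => k (t - τ)) := hk.comp_quasiMeasurePreserving
            (measurePreserving_sub_right volume τ).quasiMeasurePreserving
          rw [lintegral_mul_const'' _ hm, lintegral_sub_right_eq_self k τ]
        simp only [this]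
        rw [lintegral_const_mul'' _ (hg.pow_const 2), ← mul_assoc, sq]

theorem lintegral_conv_sq_lt_top {θ f : ℝ → ℂ} (hθ : IntegrableOn θ (Ioi 0))
    (hf : MemLp f 2 (volume.restrict (Ioi 0))) :
    ∫⁻ t, (∫⁻ τ, ‖(Ioi 0).indicator θ (t - τ) * (Ioi 0).indicator f τ‖ₑ) ^ 2 < ∞ := by
  have h1 : Integrable ((Ioi 0).indicator θ) := (integrable_indicator_iff measurableSet_Ioi).2 hθ
  have h2 : MemLp ((Ioi 0).indicator f) 2 := (memLp_indicator_iff_restrict measurableSet_Ioi).2 hf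
  simp only [enorm_mul]
  refine (lintegral_conv_sq_le (fun t => ‖(Ioi 0).indicator θ t‖ₑ)
    (fun t => ‖(Ioi 0).indicator f t‖ₑ) h1.aestronglyMeasurable.enorm
    h2.aestronglyMeasurable.enorm).trans_lt ?_
  have h3 := (eLpNorm_lt_top_iff_lintegral_rpow_enorm_lt_top two_ne_zero
    ENNReal.ofNat_ne_top).1 h2.eLpNorm_lt_top
  simp only [ENNReal.toReal_ofNat, ENNReal.rpow_two] at h3
  exact ENNReal.mul_lt_top (ENNReal.pow_lt_top h1.hasFiniteIntegral) h3

theorem intervalIntegral_conv_eq (θ f : ℝ → ℂ) {t : ℝ} (ht : 0 < t) :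
    ∫ τ in (0 : ℝ)..t, θ (t - τ) * f τ =
      ∫ τ, (Ioi 0).indicator θ (t - τ) * (Ioi 0).indicator f τ := by
  rw [intervalIntegral.integral_of_le ht.le, integral_Ioc_eq_integral_Ioo,
    ← integral_indicator measurableSet_Ioo]
  congr 1 with τ
  by_cases h1 : 0 < τ <;> by_cases h2 : τ < t <;> simp [indicator, h1, h2]

theorem memLp_conv {θ f : ℝ → ℂ} (hθ : IntegrableOn θ (Ioi 0))
    (hf : MemLp f 2 (volume.restrict (Ioi 0))) :
    MemLp (fun t => ∫ τ in (0 : ℝ)..t, θ (t - τ) * f τ) 2 (volume.restrict (Ioi 0)) := by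
  have h1 : Integrable ((Ioi 0).indicator θ) := (integrable_indicator_iff measurableSet_Ioi).2 hθ
  have h2 : MemLp ((Ioi 0).indicator f) 2 := (memLp_indicator_iff_restrict measurableSet_Ioi).2 hf
  have h3 : MemLp (fun t => ∫ τ, (Ioi 0).indicator θ (t - τ) * (Ioi 0).indicator f τ) 2 := by
    refine ⟨?_, ?_⟩
    · apply AEStronglyMeasurable.integral_prod_right'
        (f := fun p : ℝ × ℝ => (Ioi 0).indicator θ (p.1 - p.2) * (Ioi 0).indicator f p.2)
      exact (h1.aestronglyMeasurable.comp_quasiMeasurePreserving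
        (quasiMeasurePreserving_sub volume volume)).mul
        (h2.aestronglyMeasurable.comp_quasiMeasurePreserving
          Measure.quasiMeasurePreserving_snd)
    · rw [eLpNorm_lt_top_iff_lintegral_rpow_enorm_lt_top two_ne_zero ENNReal.ofNat_ne_top]
      refine lt_of_le_of_lt (lintegral_mono fun t => ?_) (lintegral_conv_sq_lt_top hθ hf)
      simp only [ENNReal.toReal_ofNat, ENNReal.rpow_two]
      exact pow_le_pow_left' (enorm_integral_le_lintegral_enorm _) 2
  refine (memLp_congr_ae ?_).1 (h3.restrict (Ioi 0))
  filter_upwards [ae_restrict_mem measurableSet_Ioi] with t ht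
  exact (intervalIntegral_conv_eq θ f ht).symm

theorem ae_integrable_conv {θ f : ℝ → ℂ} (hθ : IntegrableOn θ (Ioi 0))
    (hf : MemLp f 2 (volume.restrict (Ioi 0))) :
    ∀ᵐ t ∂(volume.restrict (Ioi (0 : ℝ))),
      IntervalIntegrable (fun τ => θ (t - τ) * f τ) volume 0 t := by
  have h1 : Integrable ((Ioi 0).indicator θ) := (integrable_indicator_iff measurableSet_Ioi).2 hθ
  have h2 : MemLp ((Ioi 0).indicator f) 2 := (memLp_indicator_iff_restrict measurableSet_Ioi).2 hf
  have hm : AEStronglyMeasurable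
      (fun p : ℝ × ℝ => (Ioi 0).indicator θ (p.1 - p.2) * (Ioi 0).indicator f p.2)
      (volume.prod volume) :=
    (h1.aestronglyMeasurable.comp_quasiMeasurePreserving
        (quasiMeasurePreserving_sub volume volume)).mul
        (h2.aestronglyMeasurable.comp_quasiMeasurePreserving
          Measure.quasiMeasurePreserving_snd)
  have hfin := ae_lt_top' (hm.enorm.lintegral_prod_right'.pow_const 2)
    (lintegral_conv_sq_lt_top hθ hf).ne
  filter_upwards [ae_restrict_mem measurableSet_Ioi, ae_restrict_of_ae hfin,
    ae_restrict_of_ae hm.prodMk_left] with t ht h4 h5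
  have h6 : Integrable (fun τ => (Ioi 0).indicator θ (t - τ) * (Ioi 0).indicator f τ) :=
    ⟨h5, by rw [hasFiniteIntegral_iff_enorm]; simpa using h4⟩
  rw [intervalIntegrable_iff_integrableOn_Ioo_of_le (le_of_lt ht)]
  refine h6.integrableOn.congr_fun (fun τ hτ => ?_) measurableSet_Ioo
  simp [indicator, hτ.1, hτ.2]

/-- The Wiener-Hopf operator
`(T f)(t) = d f(t) + ∫_0^t θ(t - τ) f(τ) dτ` on `L²[0, ∞)` with kernel `θ ∈ L¹[0, ∞)`. -/
noncomputable def wienerHopf (d : ℂ) (θ : ℝ → ℂ) (hθ : IntegrableOn θ (Ioi 0)) :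
    LTwoPlus →ₗ[ℂ] LTwoPlus where
  toFun f := d • f + (memLp_conv hθ (Lp.memLp f)).toLp _
  map_add' f g := by
    have h : (memLp_conv hθ (Lp.memLp (f + g))).toLp _ =
        (memLp_conv hθ (Lp.memLp f)).toLp _ + (memLp_conv hθ (Lp.memLp g)).toLp _ := by
      rw [← MemLp.toLp_add]
      refine MemLp.toLp_congr _ _ ?_
      filter_upwards [ae_integrable_conv hθ (Lp.memLp f), ae_integrable_conv hθ (Lp.memLp g),
        ae_restrict_mem measurableSet_Ioi] with t h1 h2 ht
      rw [Pi.add_apply, ← intervalIntegral.integral_add h1 h2]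
      refine intervalIntegral.integral_congr_ae ?_
      have h3 := (ae_restrict_iff' measurableSet_Ioi).1 (Lp.coeFn_add f g)
      filter_upwards [h3] with τ h4 hτ
      rw [h4 (by rw [uIoc_of_le (le_of_lt ht)] at hτ; exact hτ.1), Pi.add_apply, mul_add]
    rw [h, smul_add]; abel
  map_smul' c f := by
    have h : (memLp_conv hθ (Lp.memLp (c • f))).toLp _ =
        c • (memLp_conv hθ (Lp.memLp f)).toLp _ := by
      rw [← MemLp.toLp_const_smul]
      refine MemLp.toLp_congr _ _ ?_
      filter_upwards [ae_restrict_mem measurableSet_Ioi] with t ht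
      rw [Pi.smul_apply, smul_eq_mul, ← intervalIntegral.integral_const_mul]
      refine intervalIntegral.integral_congr_ae ?_
      have h3 := (ae_restrict_iff' measurableSet_Ioi).1 (Lp.coeFn_smul c f)
      filter_upwards [h3] with τ h4 hτ
      rw [h4 (by rw [uIoc_of_le (le_of_lt ht)] at hτ; exact hτ.1), Pi.smul_apply, smul_eq_mul]
      ring
    rw [h, smul_add, smul_comm, RingHom.id_apply]

theorem coeFn_wienerHopf (d : ℂ) (θ : ℝ → ℂ) (hθ : IntegrableOn θ (Ioi 0)) (f : LTwoPlus) :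
    wienerHopf d θ hθ f =ᵐ[volume.restrict (Ioi 0)]
      fun t => d * f t + ∫ τ in (0 : ℝ)..t, θ (t - τ) * f τ := by
  filter_upwards [Lp.coeFn_add (d • f) ((memLp_conv hθ (Lp.memLp f)).toLp _),
    Lp.coeFn_smul d f, (memLp_conv hθ (Lp.memLp f)).coeFn_toLp] with t h1 h2 h3
  simp only [wienerHopf, LinearMap.coe_mk, AddHom.coe_mk]
  rw [h1, Pi.add_apply, h2, h3, Pi.smul_apply, smul_eq_mul]

/-- The data of a finite Blaschke product of the right half plane: its degree `n`, a unimodular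
constant `ρ`, and its poles `α₁, …, αₙ` (with multiplicity) in the open left half plane. -/
structure Blaschke where
  deg : ℕ
  ρ : ℂ
  α : Fin deg → ℂ
  norm_ρ : ‖ρ‖ = 1
  re_neg : ∀ k, (α k).re < 0

namespace Blaschke

/-- The Blaschke product as a function, `b(s) = ρ ∏ₖ (s + conj αₖ) / (s - αₖ)`. -/
noncomputable def toFun (b : Blaschke) (s : ℂ) : ℂ :=
  b.ρ * ∏ k, (s + (starRingEnd ℂ) (b.α k)) / (s - b.α k)

/-- The Blaschke product `b̃(s) = conj (b (conj s))`; see `tilde_toFun`. -/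
noncomputable def tilde (b : Blaschke) : Blaschke where
  deg := b.deg
  ρ := (starRingEnd ℂ) b.ρ
  α k := (starRingEnd ℂ) (b.α k)
  norm_ρ := by rw [RCLike.norm_conj, b.norm_ρ]
  re_neg k := by rw [Complex.conj_re]; exact b.re_neg k

theorem tilde_toFun (b : Blaschke) (s : ℂ) :
    b.tilde.toFun s = (starRingEnd ℂ) (b.toFun ((starRingEnd ℂ) s)) := by
  simp only [toFun, tilde, map_mul, map_prod, map_div₀, map_add, map_sub, Complex.conj_conj]
  rfl

/-- The numerator polynomial `ρ ∏ₖ (s + conj αₖ)`. -/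
noncomputable def num (b : Blaschke) : ℂ[X] :=
  Polynomial.C b.ρ * ∏ k, (Polynomial.X + Polynomial.C ((starRingEnd ℂ) (b.α k)))

/-- The denominator polynomial `∏ₖ (s - αₖ)`. -/
noncomputable def den (b : Blaschke) : ℂ[X] :=
  ∏ k, (Polynomial.X - Polynomial.C (b.α k))

theorem toFun_eq (b : Blaschke) (s : ℂ) : b.toFun s = b.num.eval s / b.den.eval s := by
  simp [toFun, num, den, Polynomial.eval_prod, Finset.prod_div_distrib, mul_div_assoc]

/-- The evaluation `b(T) = ρ ∏ₖ (T + conj αₖ) (T - αₖ)⁻¹` of the rational function `b` at an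
operator `T` (all the factors commute). It is meaningful when no `αₖ` is an eigenvalue of `T`,
in particular when `T = -A` with `A` stable. -/
noncomputable def evalOp (b : Blaschke) {X : Type*} [NormedAddCommGroup X]
    [InnerProductSpace ℂ X] (T : X →L[ℂ] X) : X →L[ℂ] X :=
  Polynomial.aeval T b.num * Ring.inverse (Polynomial.aeval T b.den)

theorem laplace_exp {a s : ℂ} (ha : a.re < 0) (hs : 0 < s.re) :
    ∫ t in Ioi (0 : ℝ), Complex.exp (-(s * t)) * Complex.exp (a * t) = 1 / (s - a) := by
  have h := integral_exp_mul_complex_Ioi (a := a - s) (by simp; linarith) 0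
  have h0 : s - a ≠ 0 := fun h => by
    have := congrArg Complex.re h
    simp at this; linarith
  have h0' : a - s ≠ 0 := fun h => h0 (by linear_combination -h)
  simp only [← Complex.exp_add]
  calc _ = ∫ t in Ioi (0 : ℝ), Complex.exp ((a - s) * t) := by
        congr 1 with t; congr 1; ring
    _ = _ := by rw [h]; simp; field_simp; ring

theorem integrableOn_laplace {θ : ℝ → ℂ} (hθ : IntegrableOn θ (Ioi 0)) {s : ℂ} (hs : 0 < s.re) :
    IntegrableOn (fun t : ℝ => Complex.exp (-(s * t)) * θ t) (Ioi 0) := by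
  refine Integrable.bdd_mul (c := 1) hθ
    (by fun_prop) ?_
  filter_upwards [ae_restrict_mem measurableSet_Ioi] with t ht
  rw [Complex.norm_exp]
  refine Real.exp_le_one_iff.2 ?_
  have : 0 < s.re * t := mul_pos hs ht
  simp; linarith

theorem laplace_conv {θ κ : ℝ → ℂ} (hθ : IntegrableOn θ (Ioi 0)) (hκ : IntegrableOn κ (Ioi 0))
    {s : ℂ} (hs : 0 < s.re) :
    ∫ t in Ioi (0 : ℝ), Complex.exp (-(s * t)) * ∫ τ in (0 : ℝ)..t, θ τ * κ (t - τ) =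
      (∫ t in Ioi (0 : ℝ), Complex.exp (-(s * t)) * θ t) *
        ∫ t in Ioi (0 : ℝ), Complex.exp (-(s * t)) * κ t := by
  have h := integral_posConvolution (integrableOn_laplace hθ hs) (integrableOn_laplace hκ hs)
    (ContinuousLinearMap.mul ℝ ℂ)
  simp only [ContinuousLinearMap.mul_apply'] at h
  rw [← h]
  congr 1 with t
  rw [← intervalIntegral.integral_const_mul]
  congr 1 with τ
  have : Complex.exp (-(s * t)) = Complex.exp (-(s * τ)) * Complex.exp (-(s * ((t - τ : ℝ) : ℂ))) := by
    rw [← Complex.exp_add]; congr 1; push_cast; ring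
  rw [this]; ring

/-- Every finite Blaschke product is, up to its value `ρ` at infinity, the Laplace transform of
an integrable function. -/
theorem exists_impulse (b : Blaschke) :
    ∃ θ : ℝ → ℂ, IntegrableOn θ (Ioi 0) ∧ ∀ s : ℂ, 0 < s.re →
      b.toFun s = b.ρ + ∫ t in Ioi (0 : ℝ), Complex.exp (-(s * t)) * θ t := by
  suffices H : ∀ (n : ℕ) (ρ : ℂ) (α : Fin n → ℂ), (∀ k, (α k).re < 0) →
      ∃ θ : ℝ → ℂ, IntegrableOn θ (Ioi 0) ∧ ∀ s : ℂ, 0 < s.re →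
        ρ * ∏ k, (s + (starRingEnd ℂ) (α k)) / (s - α k) =
          ρ + ∫ t in Ioi (0 : ℝ), Complex.exp (-(s * t)) * θ t from H b.deg b.ρ b.α b.re_neg
  intro n ρ α hα
  induction n with
  | zero => exact ⟨fun _ => 0, integrableOn_zero, fun s _ => by simp⟩
  | succ n ih =>
    obtain ⟨θ, hθ, h⟩ := ih (fun k => α k.succ) (fun k => hα k.succ)
    set a := α 0 with ha
    have hare : a.re < 0 := hα 0
    have hexp : IntegrableOn (fun t : ℝ => Complex.exp (a * t)) (Ioi 0) :=
      integrableOn_exp_mul_complex_Ioi hare 0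
    have hconv : IntegrableOn (fun t : ℝ => ∫ τ in (0 : ℝ)..t, θ τ * Complex.exp (a * ((t - τ : ℝ) : ℂ)))
        (Ioi 0) := by
      have := (integrable_posConvolution hθ hexp (ContinuousLinearMap.mul ℝ ℂ)).integrableOn
        (s := Ioi 0)
      refine this.congr_fun (fun t ht => ?_) measurableSet_Ioi
      simp [posConvolution, indicator_of_mem ht]
    refine ⟨fun t => θ t + (2 * a.re : ℂ) * (ρ * Complex.exp (a * t) +
      ∫ τ in (0 : ℝ)..t, θ τ * Complex.exp (a * ((t - τ : ℝ) : ℂ))),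
      hθ.add (((hexp.const_mul ρ).add hconv).const_mul _), fun s hs => ?_⟩
    have h0 : s - a ≠ 0 := fun h => by
      have := congrArg Complex.re h
      simp at this; linarith
    have h1 := integrableOn_laplace hθ hs
    have h2 := (integrableOn_laplace hexp hs).const_mul ((2 * a.re : ℂ) * ρ)
    have h3 := (integrableOn_laplace hconv hs).const_mul (2 * a.re : ℂ)
    have h12 : Integrable (fun t : ℝ => Complex.exp (-(s * t)) * θ t + (2 * a.re : ℂ) * ρ *
        (Complex.exp (-(s * t)) * Complex.exp (a * t))) (volume.restrict (Ioi 0)) := h1.add h2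
    have h4 : ∫ t in Ioi (0 : ℝ), Complex.exp (-(s * t)) * (θ t + (2 * a.re : ℂ) *
        (ρ * Complex.exp (a * t) +
          ∫ τ in (0 : ℝ)..t, θ τ * Complex.exp (a * ((t - τ : ℝ) : ℂ)))) =
        (∫ t in Ioi (0 : ℝ), Complex.exp (-(s * t)) * θ t) + (2 * a.re : ℂ) * ρ * (1 / (s - a)) +
        (2 * a.re : ℂ) * ((∫ t in Ioi (0 : ℝ), Complex.exp (-(s * t)) * θ t) * (1 / (s - a))) := by
      rw [← laplace_exp hare hs, ← laplace_conv hθ hexp hs, ← integral_const_mul,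
        ← integral_const_mul, ← integral_add h1 h2, ← integral_add h12 h3]
      congr 1 with t
      ring
    have h5 := h s hs
    rw [h4, Fin.prod_univ_succ, ← ha]
    have h6 : (starRingEnd ℂ) a = 2 * a.re - a := by
      apply Complex.ext
      · simp; ring
      · simp
    rw [h6]
    calc _ = (s + (2 * a.re - a)) / (s - a) *
          (ρ * ∏ k : Fin n, (s + (starRingEnd ℂ) (α k.succ)) / (s - α k.succ)) := by ring
      _ = _ := by rw [h5]; field_simp; ring

/-- The function `θ ∈ L¹[0, ∞)`, unique up to null sets, with `b(s) = b(∞) + ∫_0^∞ e^{-st} θ(t) dt`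
for `Re s > 0`. -/
noncomputable def impulse (b : Blaschke) : ℝ → ℂ := b.exists_impulse.choose

theorem impulse_integrableOn (b : Blaschke) : IntegrableOn b.impulse (Ioi 0) :=
  b.exists_impulse.choose_spec.1

theorem toFun_eq_laplace (b : Blaschke) {s : ℂ} (hs : 0 < s.re) :
    b.toFun s = b.ρ + ∫ t in Ioi (0 : ℝ), Complex.exp (-(s * t)) * b.impulse t :=
  b.exists_impulse.choose_spec.2 s hs

/-- The Wiener-Hopf operator `T_b` on `L²[0, ∞)`; note that `b(∞) = ρ`. -/
noncomputable def wienerHopfOp (b : Blaschke) : LTwoPlus →ₗ[ℂ] LTwoPlus :=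
  wienerHopf b.ρ b.impulse b.impulse_integrableOn

/-- The space `H(b) = L²[0, ∞) ⊖ T_b L²[0, ∞)`. -/
noncomputable def modelSpace (b : Blaschke) : Submodule ℂ LTwoPlus :=
  (LinearMap.range b.wienerHopfOp)ᗮ

instance (b : Blaschke) : CompleteSpace b.modelSpace :=
  inferInstanceAs (CompleteSpace ((LinearMap.range b.wienerHopfOp)ᗮ : Submodule ℂ LTwoPlus))

end Blaschke

/-- The compression `Y = P_{H(φ)} | H(m) : H(m) → H(φ)` of the orthogonal projection. -/
noncomputable def compression (m φ : Blaschke) : m.modelSpace →L[ℂ] φ.modelSpace :=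
  φ.modelSpace.orthogonalProjectionOnto ∘L m.modelSpace.subtypeL

section Realization

variable {X : Type*} [NormedAddCommGroup X] [InnerProductSpace ℂ X] [CompleteSpace X]

/-- `{A, B, C, D}` is a stable dissipative (single input, single output) realization: `A` is
stable, `A + A* + C*C = 0`, `D` is unitary, and `B = -C*D`. -/
structure IsStableDissipative (A : X →L[ℂ] X) (B : ℂ →L[ℂ] X) (C : X →L[ℂ] ℂ)
    (D : ℂ →L[ℂ] ℂ) : Prop where
  stable : ∀ z : ℂ, Module.End.HasEigenvalue (A : X →ₗ[ℂ] X) z → z.re < 0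
  lyapunov : A + A.adjoint + C.adjoint ∘L C = 0
  unitary_D : D ∈ unitary (ℂ →L[ℂ] ℂ)
  input_eq : B = -(C.adjoint ∘L D)

/-- `{A, B, C, D}` is a realization of `Θ`, that is, `Θ(s) = D + C (sI - A)⁻¹ B` on the open right
half plane. -/
def IsRealization (Θ : ℂ → ℂ) (A : X →L[ℂ] X) (B : ℂ →L[ℂ] X) (C : X →L[ℂ] ℂ)
    (D : ℂ →L[ℂ] ℂ) : Prop :=
  ∀ s : ℂ, 0 < s.re → Θ s = D 1 + C (resolvent A s (B 1))

theorem hasDerivAt_semigroup (A : X →L[ℂ] X) (x : X) (t : ℝ) :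
    HasDerivAt (fun t : ℝ => NormedSpace.exp ((t : ℂ) • A) x)
      (A (NormedSpace.exp ((t : ℂ) • A) x)) t := by
  have h := (hasDerivAt_exp_smul_const' A (t : ℂ)).scomp t Complex.ofRealCLM.hasDerivAt
  have h2 := ((ContinuousLinearMap.apply ℂ X x).restrictScalars ℝ).hasFDerivAt.comp_hasDerivAt t h
  simpa [Function.comp_def] using h2

theorem memLp_observability {A : X →L[ℂ] X} {C : X →L[ℂ] ℂ}
    (h : A + A.adjoint + C.adjoint ∘L C = 0) (x : X) :
    MemLp (fun t : ℝ => C (NormedSpace.exp ((t : ℂ) • A) x)) 2 (volume.restrict (Ioi 0)) := by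
  set u : ℝ → X := fun t => NormedSpace.exp ((t : ℂ) • A) x with hu
  have hd : ∀ t, HasDerivAt u (A (u t)) t := hasDerivAt_semigroup A x
  have hc : Continuous u := continuous_iff_continuousAt.2 fun t => (hd t).continuousAt
  have hCc : Continuous fun t => C (u t) := C.continuous.comp hc
  have hn : ∀ t, HasDerivAt (fun t => RCLike.re (inner ℂ (u t) (u t))) (-‖C (u t)‖ ^ 2) t := by
    intro t
    have h1 := (RCLike.reCLM (K := ℂ)).hasFDerivAt.comp_hasDerivAt t ((hd t).inner ℂ (hd t))
    convert! h1 using 1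
    have h2 : inner ℂ ((A + A.adjoint + C.adjoint ∘L C) (u t)) (u t) = 0 := by rw [h]; simp
    simp only [add_apply, inner_add_left, ContinuousLinearMap.comp_apply,
      ContinuousLinearMap.adjoint_inner_left, inner_self_eq_norm_sq_to_K] at h2
    have h3 := congrArg RCLike.re h2
    simp only [map_add, map_zero] at h3 ⊢
    have h4 : RCLike.re ((‖C (u t)‖ : ℂ) ^ 2) = ‖C (u t)‖ ^ 2 := by
      rw [← Complex.ofReal_pow]; exact Complex.ofReal_re _
    simp only [RCLike.reCLM_apply]
    have h5 : RCLike.re ((RCLike.ofReal ‖C (u t)‖ : ℂ) ^ 2) = ‖C (u t)‖ ^ 2 := h4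
    linarith
  rw [memLp_two_iff_integrable_sq_norm hCc.aestronglyMeasurable]
  refine integrableOn_Ioi_of_intervalIntegral_norm_bounded (‖x‖ ^ 2) 0 (l := atTop) (b := id)
    (fun i => ((hCc.norm.pow 2).integrableOn_Icc).mono_set Ioc_subset_Icc_self) tendsto_id ?_
  filter_upwards with T
  have hi := intervalIntegral.integral_eq_sub_of_hasDerivAt (a := 0) (b := T)
    (fun t _ => hn t) ((hCc.norm.pow 2).neg.intervalIntegrable 0 T)
  simp only [inner_self_eq_norm_sq (𝕜 := ℂ), intervalIntegral.integral_neg] at hi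
  simp only [norm_pow, norm_norm, id]
  have h0 : u 0 = x := by simp [hu]
  rw [h0] at hi
  have := sq_nonneg ‖u T‖
  linarith

/-- The observability operator `(Γ x)(t) = C e^{At} x` from `X` into `L²[0, ∞)`. -/
noncomputable def observability {A : X →L[ℂ] X} {C : X →L[ℂ] ℂ}
    (h : A + A.adjoint + C.adjoint ∘L C = 0) : X →ₗ[ℂ] LTwoPlus where
  toFun x := (memLp_observability h x).toLp _
  map_add' x y := by
    rw [← MemLp.toLp_add]
    exact MemLp.toLp_congr _ _ (ae_of_all _ fun t => by simp)
  map_smul' c x := by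
    rw [RingHom.id_apply, ← MemLp.toLp_const_smul]
    exact MemLp.toLp_congr _ _ (ae_of_all _ fun t => by simp)

/-- The defect operator `D_T = (I - T*T)^{1/2}` of a contraction `T`. -/
noncomputable def defectOp (T : X →L[ℂ] X) : X →L[ℂ] X :=
  CFC.sqrt (1 - T.adjoint * T)

/-- The defect space, the range of the defect operator (closed when `X` is finite dimensional). -/
noncomputable def defectSpace (T : X →L[ℂ] X) : Submodule ℂ X :=
  LinearMap.range (defectOp T : X →ₗ[ℂ] X)

/-- The defect index, the dimension of the defect space (of a contraction on a finite dimensional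
space). -/
noncomputable def defectIndex (T : X →L[ℂ] X) : ℕ :=
  Module.finrank ℂ (defectSpace T)

end Realization

/-!
The exponentials `e_s(t) = e^{-s̄ t}`, `Re s > 0`, are total in `L²[0, ∞)`: the inner product with
`e_s` is the Laplace transform at `s`, and a function is determined by its transform on a vertical
line (`eq_zero_of_inner_expVec`). On the transform side `T_b` is multiplication by `b`, hence
`T_b† e_s = conj (b(s)) e_s`, and identities between operators can be tested on the `e_s`, where
they become identities between rational functions. For one Blaschke factor, a partial fraction
decomposition of `T_b e_s` gives that `T_b` is isometric with a one-dimensional kernel of the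
adjoint. As `T_b` is the product of the operators of the factors, it is isometric and
`dim H(b) = deg b` (`Blaschke.adjoint_comp_multOp`, `Blaschke.rank_modelSpace`). In the same way,
`T_b† Γ = Γ b̃(-A)` for the observability operator `Γ` (`adjoint_multOp_observability`).

For a stable dissipative realization of `m` one has `Γ Γ† = 1 - T_m T_m†`, because both sides have
the same matrix entries in the `e_s` (`observability_comp_adjoint`). As `Γ` is injective, it is an
isometry onto `H(m)`; in particular the state space has dimension `deg m`. Therefore
`‖P_{H(φ)} Γ x‖² = ‖Γ x‖² - ‖T_φ† Γ x‖² = ‖x‖² - ‖φ̃(-A) x‖²`, which is the square of the norm of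
`D_{φ̃(-A)} x`. This yields the unitary operator `Ψ` and identifies the rank of `Y` with a defect
index.

The defect indices are computed algebraically. By the Lyapunov equation each Blaschke factor of
`b(-A)` loses an energy `|C z|²`, up to a positive factor, so that the defect operator of `b(-A)`
vanishes at `den(-A) y` exactly when `C q(-A) y = 0` for all polynomials `q` of degree less than
`deg b` (`norm_num_le_norm_den`). Observability makes these `min (deg b) (dim X)` independent
conditions (`finrank_unobservable`).

Finally, if `x` is orthogonal to the defect space, then `Γ x = T_φ Γ φ̃(-A) x`. The Laplace
transform of this is the quotient formula for `Re s > 0`, and it extends to the resolvent set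
because both sides are rational.
-/

open scoped FourierTransform SchwartzMap ContDiff ComplexConjugate InnerProductSpace

/-! ### The Laplace transform on `L²[0, ∞)` -/

/-- The Fourier transform is injective on `L¹(ℝ)`. -/
theorem ae_eq_zero_of_fourier_eq_zero {g : ℝ → ℂ} (hg : Integrable g) (h : ∀ y, 𝓕 g y = 0) :
    g =ᵐ[volume] 0 := by
  have key : ∀ k : 𝓢(ℝ, ℂ), ∫ x, g x * k x = 0 := by
    intro k
    have h1 := VectorFourier.integral_fourierIntegral_smul_eq_flip (L := innerₗ ℝ) (μ := volume)
      (ν := volume) Real.continuous_fourierChar continuous_inner hg (𝓕⁻ k).integrable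
    have h2 : ∀ x, VectorFourier.fourierIntegral Real.fourierChar volume (innerₗ ℝ).flip
        (𝓕⁻ k : 𝓢(ℝ, ℂ)) x = k x := by
      intro x
      have h3 : (𝓕 (𝓕⁻ k) : 𝓢(ℝ, ℂ)) x = k x := by simp
      rw [← h3, SchwartzMap.fourier_coe]
      simp [VectorFourier.fourierIntegral, Real.fourier_eq]
    simp only [h2, smul_eq_mul] at h1
    rw [← h1]
    have h4 : ∀ y, VectorFourier.fourierIntegral Real.fourierChar volume (innerₗ ℝ) g y = 0 := h
    simp [h4]
  refine ae_eq_zero_of_integral_contDiff_smul_eq_zero hg.locallyIntegrable fun k hk hkc => ?_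
  have hg₁ : HasCompactSupport (Complex.ofRealCLM ∘ k) := hkc.comp_left rfl
  have hg₂ : ContDiff ℝ ∞ (Complex.ofRealCLM ∘ k) := by fun_prop
  have := key (hg₁.toSchwartzMap hg₂)
  simpa [mul_comm] using this

theorem memLp_exp {s : ℂ} (hs : 0 < s.re) :
    MemLp (fun t : ℝ => Complex.exp (-(conj s * t))) 2 (volume.restrict (Ioi 0)) := by
  rw [memLp_two_iff_integrable_sq_norm (by fun_prop)]
  have h := integrableOn_exp_mul_Ioi (a := -(2 * s.re)) (by linarith) 0
  refine h.congr_fun (fun t _ => ?_) measurableSet_Ioi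
  simp only [Complex.norm_exp, ← Real.exp_nat_mul]
  congr 1
  simp; ring

/-- The exponential `t ↦ e^{-s̄ t}` in `L²[0, ∞)`, for `Re s > 0`; the inner product with it is
the Laplace transform at `s`. Outside the right half plane the value is `0`. -/
noncomputable def expVec (s : ℂ) : LTwoPlus :=
  if h : 0 < s.re then (memLp_exp h).toLp _ else 0

theorem coeFn_expVec {s : ℂ} (hs : 0 < s.re) :
    expVec s =ᵐ[volume.restrict (Ioi 0)] fun t : ℝ => Complex.exp (-(conj s * t)) := by
  rw [expVec, dif_pos hs]
  exact MemLp.coeFn_toLp _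

theorem inner_expVec {s : ℂ} (hs : 0 < s.re) (f : LTwoPlus) :
    ⟪expVec s, f⟫_ℂ = ∫ t in Ioi (0 : ℝ), Complex.exp (-(s * t)) * f t := by
  rw [MeasureTheory.L2.inner_def]
  refine integral_congr_ae ?_
  filter_upwards [coeFn_expVec hs] with t ht
  rw [ht, RCLike.inner_apply, ← Complex.exp_conj]
  simp [mul_comm]

theorem integrableOn_exp_mul {s : ℂ} (hs : 0 < s.re) (f : LTwoPlus) :
    IntegrableOn (fun t : ℝ => Complex.exp (-(s * t)) * f t) (Ioi 0) := by
  have h := memLp_exp (s := conj s) (by simpa using hs)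
  simp only [Complex.conj_conj] at h
  exact h.integrable_mul (Lp.memLp f)

/-- A square integrable function is determined by its Laplace transform on a vertical line. -/
theorem eq_zero_of_inner_expVec {c : ℝ} (hc : 0 < c) {f : LTwoPlus}
    (h : ∀ s : ℂ, s.re = c → ⟪expVec s, f⟫_ℂ = 0) : f = 0 := by
  have hi := integrableOn_exp_mul (s := c) (by simpa using hc) f
  rw [← integrable_indicator_iff measurableSet_Ioi] at hi
  have h0 := ae_eq_zero_of_fourier_eq_zero hi (fun y => by
    have h1 := h (c + 2 * Real.pi * y * Complex.I) (by simp)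
    rw [inner_expVec (by simpa using hc)] at h1
    rw [Real.fourier_real_eq_integral_exp_smul, ← h1, ← integral_indicator measurableSet_Ioi]
    congr 1 with t
    by_cases ht : t ∈ Ioi (0 : ℝ)
    · simp only [indicator_of_mem ht, smul_eq_mul, ← mul_assoc, ← Complex.exp_add]
      congr 2
      push_cast; ring
    · simp [indicator_of_notMem ht])
  rw [Lp.eq_zero_iff_ae_eq_zero]
  filter_upwards [ae_restrict_of_ae h0, ae_restrict_mem measurableSet_Ioi] with t ht h1
  rw [indicator_of_mem h1] at ht
  simpa using ht

theorem ext_inner_expVec {c : ℝ} (hc : 0 < c) {f g : LTwoPlus}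
    (h : ∀ s : ℂ, s.re = c → ⟪expVec s, f⟫_ℂ = ⟪expVec s, g⟫_ℂ) : f = g := by
  rw [← sub_eq_zero]
  refine eq_zero_of_inner_expVec hc fun s hs => ?_
  rw [inner_sub_right, h s hs, sub_self]

theorem inner_expVec_expVec {s w : ℂ} (hs : 0 < s.re) (hw : 0 < w.re) :
    ⟪expVec s, expVec w⟫_ℂ = 1 / (s + conj w) := by
  rw [inner_expVec hs]
  have h := Blaschke.laplace_exp (a := -conj w) (s := s) (by simpa using hw) hs
  rw [sub_neg_eq_add] at h
  rw [← h]
  refine integral_congr_ae ?_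
  filter_upwards [coeFn_expVec hw] with t ht
  rw [ht, neg_mul]

/-- The Laplace transform turns the Wiener-Hopf operator into multiplication by its symbol. -/
theorem inner_expVec_wienerHopfOp (b : Blaschke) {s : ℂ} (hs : 0 < s.re) (f : LTwoPlus) :
    ⟪expVec s, b.wienerHopfOp f⟫_ℂ = b.toFun s * ⟪expVec s, f⟫_ℂ := by
  have hf := integrableOn_exp_mul hs f
  have hθ := Blaschke.integrableOn_laplace b.impulse_integrableOn hs
  have hconv := integral_posConvolution hf hθ (ContinuousLinearMap.mul ℝ ℂ)
  have hcoe := coeFn_wienerHopf b.ρ b.impulse b.impulse_integrableOn f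
  -- `f` need not be integrable, but `e^{-st} f` is, and the weight is multiplicative under convolution
  have hpt : ∀ t : ℝ, ∫ τ in (0 : ℝ)..t, (ContinuousLinearMap.mul ℝ ℂ)
      (Complex.exp (-(s * τ)) * f τ) (Complex.exp (-(s * ((t - τ : ℝ) : ℂ))) * b.impulse (t - τ)) =
      Complex.exp (-(s * t)) * ∫ τ in (0 : ℝ)..t, b.impulse (t - τ) * f τ := by
    intro t
    rw [← intervalIntegral.integral_const_mul]
    congr 1 with τ
    have : Complex.exp (-(s * t)) = Complex.exp (-(s * τ)) *
        Complex.exp (-(s * ((t - τ : ℝ) : ℂ))) := by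
      rw [← Complex.exp_add]; congr 1; push_cast; ring
    rw [this, ContinuousLinearMap.mul_apply']; ring
  simp only [hpt] at hconv
  rw [ContinuousLinearMap.mul_apply'] at hconv
  have hW := integrableOn_exp_mul hs (b.wienerHopfOp f)
  have hg : IntegrableOn (fun t : ℝ => Complex.exp (-(s * t)) *
      ∫ τ in (0 : ℝ)..t, b.impulse (t - τ) * f τ) (Ioi 0) := by
    refine (hW.sub (hf.const_mul b.ρ)).congr ?_
    filter_upwards [hcoe] with t ht
    rw [Pi.sub_apply, Blaschke.wienerHopfOp, ht]; ring
  rw [inner_expVec hs, inner_expVec hs, b.toFun_eq_laplace hs, add_mul, mul_comm (∫ _ in _, _),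
    ← hconv, ← integral_const_mul, ← integral_add (hf.const_mul b.ρ) hg]
  refine integral_congr_ae ?_
  filter_upwards [hcoe] with t ht
  rw [Blaschke.wienerHopfOp, ht]; ring

section Realization

variable {X : Type*} [NormedAddCommGroup X] [InnerProductSpace ℂ X] [CompleteSpace X]

theorem re_inner_of_lyapunov {A : X →L[ℂ] X} {C : X →L[ℂ] ℂ}
    (h : A + A.adjoint + C.adjoint ∘L C = 0) (x : X) :
    2 * (⟪x, A x⟫_ℂ).re = -‖C x‖ ^ 2 := by
  have h1 : ⟪x, (A + A.adjoint + C.adjoint ∘L C) x⟫_ℂ = 0 := by rw [h]; simp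
  simp only [add_apply, inner_add_right, ContinuousLinearMap.comp_apply,
    ContinuousLinearMap.adjoint_inner_right] at h1
  rw [← inner_conj_symm (A x) x, inner_self_eq_norm_sq_to_K] at h1
  have h2 := congrArg Complex.re h1
  have h3 : ((RCLike.ofReal ‖C x‖ : ℂ) ^ 2).re = ‖C x‖ ^ 2 := by
    rw [← RCLike.ofReal_pow]; exact Complex.ofReal_re _
  rw [Complex.add_re, Complex.add_re, Complex.conj_re, h3, Complex.zero_re] at h2
  linarith

theorem norm_semigroup_le {A : X →L[ℂ] X} {C : X →L[ℂ] ℂ}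
    (h : A + A.adjoint + C.adjoint ∘L C = 0) (x : X) {t : ℝ} (ht : 0 ≤ t) :
    ‖NormedSpace.exp ((t : ℂ) • A) x‖ ≤ ‖x‖ := by
  set u : ℝ → X := fun t => NormedSpace.exp ((t : ℂ) • A) x with hu
  have hn : ∀ t, HasDerivAt (fun t => ‖u t‖ ^ 2) (-‖C (u t)‖ ^ 2) t := by
    intro t
    let : InnerProductSpace ℝ X := InnerProductSpace.rclikeToReal ℂ X
    have h1 := (hasDerivAt_semigroup A x t).norm_sq
    convert! h1 using 1
    rw [real_inner_eq_re_inner ℂ]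
    exact (re_inner_of_lyapunov h (u t)).symm
  have hanti : Antitone fun t => ‖u t‖ ^ 2 :=
    antitone_of_hasDerivAt_nonpos hn fun t => by simp
  have h2 := hanti ht
  have h0 : u 0 = x := by simp [hu]
  simp only [h0] at h2
  exact le_of_sq_le_sq h2 (norm_nonneg _)

/-- The Laplace transform of `t ↦ C e^{At} x` is `C (s - A)⁻¹ x`. -/
theorem inner_expVec_observability {A : X →L[ℂ] X} {C : X →L[ℂ] ℂ}
    (h : A + A.adjoint + C.adjoint ∘L C = 0) {s : ℂ} (hs : 0 < s.re) (hA : s ∈ resolventSet ℂ A)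
    (x : X) : ⟪expVec s, observability h x⟫_ℂ = C (resolvent A s x) := by
  have hcoe : observability h x =ᵐ[volume.restrict (Ioi 0)]
      fun t : ℝ => C (NormedSpace.exp ((t : ℂ) • A) x) := (memLp_observability h x).coeFn_toLp
  have hint := integrableOn_exp_mul hs (observability h x)
  have hcongr : (fun t : ℝ => Complex.exp (-(s * t)) * observability h x t)
      =ᵐ[volume.restrict (Ioi 0)]
      fun t : ℝ => Complex.exp (-(s * t)) * C (NormedSpace.exp ((t : ℂ) • A) x) := by
    filter_upwards [hcoe] with t ht
    rw [ht]
  rw [inner_expVec hs, integral_congr_ae hcongr]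
  set R := resolvent A s with hR
  have hRA : ∀ y, R (s • y - A y) = y := fun y => by
    have h1 : R * (algebraMap ℂ (X →L[ℂ] X) s - A) = 1 := Ring.inverse_mul_cancel _ hA
    simpa [Algebra.algebraMap_eq_smul_one] using congrArg (fun T : X →L[ℂ] X => T y) h1
  have hd : ∀ t : ℝ, HasDerivAt
      (fun t : ℝ => -(Complex.exp (-(s * t)) * C (R (NormedSpace.exp ((t : ℂ) • A) x))))
      (Complex.exp (-(s * t)) * C (NormedSpace.exp ((t : ℂ) • A) x)) t := by
    intro t
    have h1 : HasDerivAt (fun t : ℝ => Complex.exp (-(s * t))) (Complex.exp (-(s * t)) * (-s)) t := by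
      have h2 : HasDerivAt (fun t : ℝ => -(s * (t : ℂ))) (-s) t := by
        simpa using ((Complex.ofRealCLM.hasDerivAt (x := t)).const_mul s).fun_neg
      exact h2.cexp
    have h3 := ((C ∘L R).restrictScalars ℝ).hasFDerivAt.comp_hasDerivAt t
      (hasDerivAt_semigroup A x t)
    convert! (h1.mul h3).neg using 1
    simp only [ContinuousLinearMap.coe_restrictScalars', ContinuousLinearMap.comp_apply,
      Function.comp]
    conv_lhs => rw [← hRA (NormedSpace.exp ((t : ℂ) • A) x)]
    simp only [map_sub, map_smul, smul_eq_mul]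
    ring
  have hlim : Tendsto
      (fun t : ℝ => -(Complex.exp (-(s * t)) * C (R (NormedSpace.exp ((t : ℂ) • A) x))))
      atTop (𝓝 0) := by
    have hb : Tendsto (fun t : ℝ => Real.exp (-(s.re * t)) * (‖C ∘L R‖ * ‖x‖)) atTop (𝓝 0) := by
      have h1 : Tendsto (fun t : ℝ => Real.exp (-(s.re * t))) atTop (𝓝 0) :=
        Real.tendsto_exp_neg_atTop_nhds_zero.comp (tendsto_id.const_mul_atTop hs)
      simpa using h1.mul_const (‖C ∘L R‖ * ‖x‖)
    refine squeeze_zero_norm' ?_ hb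
    filter_upwards [eventually_ge_atTop 0] with t ht
    rw [norm_neg, norm_mul, Complex.norm_exp]
    have h1 : (-(s * (t : ℂ))).re = -(s.re * t) := by simp
    rw [h1]
    gcongr
    exact ((C ∘L R).le_opNorm _).trans (by gcongr; exact norm_semigroup_le h x ht)
  rw [integral_Ioi_of_hasDerivAt_of_tendsto' (fun t _ => hd t) (hint.congr hcongr) hlim]
  simp

end Realization

/-! ### Blaschke products built from their factors -/

namespace Blaschke

/-- The Blaschke product of degree `0` with value `ρ`. -/
noncomputable def const (ρ : ℂ) (hρ : ‖ρ‖ = 1) : Blaschke where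
  deg := 0
  ρ := ρ
  α k := k.elim0
  norm_ρ := hρ
  re_neg k := k.elim0

/-- The Blaschke product `(s + ā) / (s - a) * b(s)`. -/
noncomputable def cons (a : ℂ) (ha : a.re < 0) (b : Blaschke) : Blaschke where
  deg := b.deg + 1
  ρ := b.ρ
  α := Fin.cons a b.α
  norm_ρ := b.norm_ρ
  re_neg := Fin.cases ha b.re_neg

theorem deg_const (ρ : ℂ) (hρ : ‖ρ‖ = 1) : (const ρ hρ).deg = 0 := rfl

theorem deg_cons (a : ℂ) (ha : a.re < 0) (b : Blaschke) : (cons a ha b).deg = b.deg + 1 := rfl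

theorem cons_induction {P : Blaschke → Prop} (const : ∀ ρ hρ, P (const ρ hρ))
    (cons : ∀ a ha b, P b → P (cons a ha b)) (b : Blaschke) : P b := by
  obtain ⟨n, ρ, α, hρ, hα⟩ := b
  induction n with
  | zero =>
    have h : α = fun k => k.elim0 := funext fun k => k.elim0
    subst h
    exact const ρ hρ
  | succ n ih =>
    have h := cons (α 0) (hα 0) _ (ih (Fin.tail α) fun k => hα k.succ)
    have h1 : Fin.cons (α 0) (Fin.tail α) = α := Fin.cons_self_tail α
    simp only [Blaschke.cons] at h
    convert! h
    exact h1.symm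

theorem toFun_const (ρ : ℂ) (hρ : ‖ρ‖ = 1) (s : ℂ) : (const ρ hρ).toFun s = ρ := by
  change ρ * ∏ k : Fin 0, _ = ρ
  simp

theorem toFun_cons (a : ℂ) (ha : a.re < 0) (b : Blaschke) (s : ℂ) :
    (cons a ha b).toFun s = (s + conj a) / (s - a) * b.toFun s := by
  change b.ρ * ∏ k : Fin (b.deg + 1), _ = _ * (b.ρ * _)
  rw [Fin.prod_univ_succ, mul_left_comm]
  rfl

theorem num_const (ρ : ℂ) (hρ : ‖ρ‖ = 1) : (const ρ hρ).num = Polynomial.C ρ := by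
  change Polynomial.C ρ * ∏ k : Fin 0, _ = _
  simp

theorem den_const (ρ : ℂ) (hρ : ‖ρ‖ = 1) : (const ρ hρ).den = 1 :=
  Fin.prod_univ_zero _

theorem num_cons (a : ℂ) (ha : a.re < 0) (b : Blaschke) :
    (cons a ha b).num = (Polynomial.X + Polynomial.C (conj a)) * b.num := by
  change Polynomial.C b.ρ * ∏ k : Fin (b.deg + 1), _ = _ * (Polynomial.C b.ρ * _)
  rw [Fin.prod_univ_succ, mul_left_comm]
  rfl

theorem den_cons (a : ℂ) (ha : a.re < 0) (b : Blaschke) :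
    (cons a ha b).den = (Polynomial.X - Polynomial.C a) * b.den :=
  Fin.prod_univ_succ _

theorem degree_den (b : Blaschke) : b.den.degree = b.deg := by
  simp [den, Polynomial.degree_prod]

theorem tilde_const (ρ : ℂ) (hρ : ‖ρ‖ = 1) :
    (const ρ hρ).tilde = const (conj ρ) (by rwa [RCLike.norm_conj]) := by
  simp only [tilde, const, mk.injEq, heq_eq_eq, true_and]
  exact funext fun k => k.elim0

theorem tilde_cons (a : ℂ) (ha : a.re < 0) (b : Blaschke) :
    (cons a ha b).tilde = cons (conj a) (by rwa [Complex.conj_re]) b.tilde := by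
  simp only [tilde, cons, mk.injEq, heq_eq_eq, true_and]
  refine funext fun k => ?_
  cases k using Fin.cases <;> simp

theorem den_eval_ne_zero (b : Blaschke) {s : ℂ} (hs : 0 ≤ s.re) : b.den.eval s ≠ 0 := by
  rw [den, Polynomial.eval_prod, Finset.prod_ne_zero_iff]
  intro k _ h
  have h1 := congrArg Complex.re (show s - b.α k = 0 by simpa using h)
  have h2 := b.re_neg k
  rw [Complex.sub_re, Complex.zero_re] at h1
  linarith

theorem num_eval_ne_zero (b : Blaschke) {s : ℂ} (hs : s.re ≤ 0) : b.num.eval s ≠ 0 := by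
  rw [num, Polynomial.eval_mul, Polynomial.eval_prod, Polynomial.eval_C]
  refine mul_ne_zero (norm_ne_zero_iff.1 (b.norm_ρ ▸ one_ne_zero)) ?_
  rw [Finset.prod_ne_zero_iff]
  intro k _ h
  have h1 := congrArg Complex.re (show s + conj (b.α k) = 0 by simpa using h)
  have h2 := b.re_neg k
  rw [Complex.add_re, Complex.conj_re, Complex.zero_re] at h1
  linarith

end Blaschke

/-! ### Blaschke products evaluated at a dissipative operator -/

section Resolvent

variable {X : Type*} [NormedAddCommGroup X] [InnerProductSpace ℂ X]

theorem mem_resolventSet_of_stable [FiniteDimensional ℂ X] {A : X →L[ℂ] X}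
    (hA : ∀ z : ℂ, Module.End.HasEigenvalue (A : X →ₗ[ℂ] X) z → z.re < 0) {s : ℂ}
    (hs : 0 ≤ s.re) : s ∈ resolventSet ℂ A := by
  have : CompleteSpace X := FiniteDimensional.complete ℂ X
  rw [spectrum.mem_resolventSet_iff, ContinuousLinearMap.isUnit_iff_bijective]
  have hinj : Function.Injective (algebraMap ℂ (X →L[ℂ] X) s - A) := by
    rw [injective_iff_map_eq_zero]
    intro x hx
    by_contra hx0
    have h1 : s • x - A x = 0 := by
      simpa [Algebra.algebraMap_eq_smul_one] using hx
    have := hA s (Module.End.hasEigenvalue_of_hasEigenvector (Module.End.hasEigenvector_iff.2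
      ⟨Module.End.mem_eigenspace_iff.2 (sub_eq_zero.1 h1).symm, hx0⟩))
    linarith
  exact ⟨hinj, (LinearMap.injective_iff_surjective
    (f := ((algebraMap ℂ (X →L[ℂ] X) s - A : X →L[ℂ] X) : X →ₗ[ℂ] X))).1 hinj⟩

theorem resolvent_apply_sub {A : X →L[ℂ] X} {s : ℂ} (hs : s ∈ resolventSet ℂ A) (y : X) :
    resolvent A s (s • y - A y) = y := by
  have h1 : resolvent A s * (algebraMap ℂ (X →L[ℂ] X) s - A) = 1 := Ring.inverse_mul_cancel _ hs
  simpa [Algebra.algebraMap_eq_smul_one] using congrArg (fun T : X →L[ℂ] X => T y) h1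

theorem isUnit_aeval_den {A : X →L[ℂ] X} (hA : ∀ s : ℂ, 0 ≤ s.re → s ∈ resolventSet ℂ A)
    (b : Blaschke) : IsUnit (Polynomial.aeval (-A) b.den) := by
  induction b using Blaschke.cons_induction with
  | const ρ hρ => rw [Blaschke.den_const, map_one]; exact isUnit_one
  | cons a ha b ih =>
    rw [Blaschke.den_cons, map_mul, map_sub, Polynomial.aeval_X, Polynomial.aeval_C]
    refine IsUnit.mul ?_ ih
    have h := hA (-a) (by rw [Complex.neg_re]; linarith)
    rwa [spectrum.mem_resolventSet_iff, map_neg, neg_sub_left, add_comm, ← neg_sub_left] at h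

theorem evalOp_aeval_den {A : X →L[ℂ] X} (hA : ∀ s : ℂ, 0 ≤ s.re → s ∈ resolventSet ℂ A)
    (b : Blaschke) (y : X) :
    b.evalOp (-A) (Polynomial.aeval (-A) b.den y) = Polynomial.aeval (-A) b.num y := by
  have h := Ring.inverse_mul_cancel _ (isUnit_aeval_den hA b)
  rw [Blaschke.evalOp, mul_apply_eq_comp]
  congr 1
  exact congrArg (fun T : X →L[ℂ] X => T y) h

theorem exists_aeval_den_eq {A : X →L[ℂ] X} (hA : ∀ s : ℂ, 0 ≤ s.re → s ∈ resolventSet ℂ A)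
    (b : Blaschke) (x : X) : ∃ y, Polynomial.aeval (-A) b.den y = x :=
  ⟨Ring.inverse (Polynomial.aeval (-A) b.den) x, congrArg (fun T : X →L[ℂ] X => T x)
    (Ring.mul_inverse_cancel _ (isUnit_aeval_den hA b))⟩

/-- The vectors `y` that cannot be told from `0` by the first `n` of the functionals
`C, C T, C T², …`. -/
def unobservable (T : X →L[ℂ] X) (C : X →L[ℂ] ℂ) (n : ℕ) : Submodule ℂ X where
  carrier := {y | ∀ q : ℂ[X], q.degree < n → C (Polynomial.aeval T q y) = 0}
  add_mem' hx hy q hq := by rw [map_add, map_add, hx q hq, hy q hq, add_zero]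
  zero_mem' q _ := by rw [map_zero, map_zero]
  smul_mem' c x hx q hq := by rw [map_smul, map_smul, hx q hq, smul_zero]

theorem mem_unobservable {T : X →L[ℂ] X} {C : X →L[ℂ] ℂ} {n : ℕ} {y : X} :
    y ∈ unobservable T C n ↔ ∀ q : ℂ[X], q.degree < n → C (Polynomial.aeval T q y) = 0 :=
  Iff.rfl

/-- The polynomials of degree at most `n` are spanned by the multiples of `X - μ` among them and any
`p` of degree `n` with `p(μ) ≠ 0`. -/
theorem mem_unobservable_succ {T : X →L[ℂ] X} {C : X →L[ℂ] ℂ} {n : ℕ} {y : X} {p : ℂ[X]} {μ : ℂ}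
    (hp : p.degree = n) (hμ : p.eval μ ≠ 0) :
    y ∈ unobservable T C (n + 1) ↔
      C (Polynomial.aeval T p y) = 0 ∧ T y - μ • y ∈ unobservable T C n := by
  have hT : ∀ r : ℂ[X], Polynomial.aeval T r (T y - μ • y) =
      Polynomial.aeval T (r * (Polynomial.X - Polynomial.C μ)) y := fun r => by
    simp [Algebra.algebraMap_eq_smul_one]
  refine ⟨fun h => ⟨h p ?_, fun q hq => ?_⟩, fun ⟨h1, h2⟩ q hq => ?_⟩
  · rw [hp]; exact_mod_cast Nat.lt_succ_self n
  · rw [hT]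
    refine h _ ?_
    rw [Polynomial.degree_mul, Polynomial.degree_X_sub_C]
    rcases eq_or_ne q 0 with rfl | h0
    · simp
    · rw [Polynomial.degree_eq_natDegree h0] at hq ⊢
      norm_cast at hq ⊢
      omega
  · set k := q.eval μ / p.eval μ with hk
    obtain ⟨r, hr⟩ : (Polynomial.X - Polynomial.C μ) ∣ q - Polynomial.C k * p := by
      rw [Polynomial.dvd_iff_isRoot, Polynomial.IsRoot, Polynomial.eval_sub, Polynomial.eval_mul,
        Polynomial.eval_C, hk, div_mul_cancel₀ _ hμ, sub_self]
    have hq' : q = Polynomial.C k * p + r * (Polynomial.X - Polynomial.C μ) := by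
      rw [mul_comm r, ← hr]; ring
    have hdeg : (r * (Polynomial.X - Polynomial.C μ)).degree < ((n + 1 : ℕ) : WithBot ℕ) := by
      rw [mul_comm, ← hr]
      refine lt_of_le_of_lt (Polynomial.degree_sub_le _ _) (max_lt hq ?_)
      rw [← Polynomial.smul_eq_C_mul]
      refine lt_of_le_of_lt (Polynomial.degree_smul_le _ _) ?_
      rw [hp]; exact_mod_cast Nat.lt_succ_self n
    have hr2 : r.degree < n := by
      rw [Polynomial.degree_mul, Polynomial.degree_X_sub_C] at hdeg
      rcases eq_or_ne r 0 with rfl | h0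
      · simp
      · rw [Polynomial.degree_eq_natDegree h0] at hdeg ⊢
        norm_cast at hdeg ⊢
        omega
    have h3 := h2 r hr2
    rw [hT] at h3
    rw [hq', map_add, ← Polynomial.smul_eq_C_mul, map_smul, add_apply, smul_apply, map_add,
      map_smul, h1, h3, smul_zero, add_zero]

theorem aeval_charpoly_eq_zero [FiniteDimensional ℂ X] (T : X →L[ℂ] X) :
    Polynomial.aeval T (LinearMap.charpoly (T : X →ₗ[ℂ] X)) = 0 := by
  have h1 := LinearMap.aeval_self_charpoly (T : X →ₗ[ℂ] X)
  have h2 : ContinuousLinearMap.toLinearMapRingHom (R₁ := ℂ) (M₁ := X)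
      (Polynomial.aeval T (LinearMap.charpoly (T : X →ₗ[ℂ] X))) = 0 := by
    rw [← h1, Polynomial.aeval_def, Polynomial.hom_eval₂]
    rfl
  exact ContinuousLinearMap.coe_injective h2

/-- For an observable pair each of the first `dim X` functionals `C, C T, C T², …` lowers the
dimension by one. -/
theorem finrank_unobservable [FiniteDimensional ℂ X] {T : X →L[ℂ] X} {C : X →L[ℂ] ℂ}
    (hobs : ∀ y, (∀ q : ℂ[X], C (Polynomial.aeval T q y) = 0) → y = 0) (n : ℕ) :
    Module.finrank ℂ (unobservable T C n) + min n (Module.finrank ℂ X) = Module.finrank ℂ X := by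
  set L : (n : ℕ) → X →ₗ[ℂ] (Fin n → ℂ) := fun n =>
    LinearMap.pi fun i : Fin n => ((C ∘L T ^ (i : ℕ) : X →L[ℂ] ℂ) : X →ₗ[ℂ] ℂ) with hL
  have hker : ∀ n, LinearMap.ker (L n) = unobservable T C n := by
    intro n
    ext y
    rw [LinearMap.mem_ker, mem_unobservable]
    refine ⟨fun h q hq => ?_, fun h => funext fun i => ?_⟩
    · rw [Polynomial.aeval_eq_sum_range]
      simp only [sum_apply, map_sum]
      refine Finset.sum_eq_zero fun i _ => ?_
      rw [smul_apply, map_smul]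
      by_cases hi : i < n
      · have h1 : C ((T ^ i) y) = 0 := congrFun h ⟨i, hi⟩
        rw [h1, smul_zero]
      · rw [Polynomial.coeff_eq_zero_of_degree_lt (hq.trans_le (by exact_mod_cast not_lt.1 hi)),
          zero_smul]
    · have := h (Polynomial.X ^ (i : ℕ)) (by
        rw [Polynomial.degree_X_pow]; exact_mod_cast i.2)
      rwa [map_pow, Polynomial.aeval_X] at this
  have hbot : unobservable T C (Module.finrank ℂ X) = ⊥ := by
    rw [eq_bot_iff]
    refine fun y hy => hobs y fun q => ?_
    set χ := LinearMap.charpoly (T : X →ₗ[ℂ] X) with hχ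
    have hχT : Polynomial.aeval T χ = 0 := aeval_charpoly_eq_zero T
    have hmon : χ.Monic := LinearMap.charpoly_monic _
    rw [← Polynomial.modByMonic_add_div q χ, map_add, map_mul, hχT, zero_mul, add_zero]
    refine hy _ ((Polynomial.degree_modByMonic_lt q hmon).trans_eq ?_)
    rw [Polynomial.degree_eq_natDegree hmon.ne_zero, LinearMap.charpoly_natDegree]
  rcases le_total n (Module.finrank ℂ X) with hn | hn
  · have hsurj : Function.Surjective (L (Module.finrank ℂ X)) := by
      refine (LinearMap.injective_iff_surjective_of_finrank_eq_finrank (by simp)).1 ?_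
      rw [← LinearMap.ker_eq_bot, hker, hbot]
    have hcomp : L n = LinearMap.funLeft ℂ ℂ (Fin.castLE hn) ∘ₗ L (Module.finrank ℂ X) := rfl
    have hsurj' : LinearMap.range (L n) = ⊤ := by
      rw [LinearMap.range_eq_top, hcomp]
      exact (LinearMap.funLeft_surjective_of_injective ℂ ℂ _ (Fin.castLE_injective hn)).comp hsurj
    have h1 := LinearMap.finrank_range_add_finrank_ker (L n)
    rw [hsurj', finrank_top, Module.finrank_fin_fun, hker] at h1
    rw [min_eq_left hn]; omega
  · have h1 : unobservable T C n = ⊥ := by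
      rw [eq_bot_iff, ← hbot]
      exact fun y hy q hq => hy q (hq.trans_le (by exact_mod_cast hn))
    rw [h1, finrank_bot, min_eq_right hn, zero_add]

end Resolvent

section Lyapunov

variable {X : Type*} [NormedAddCommGroup X] [InnerProductSpace ℂ X] [CompleteSpace X]

/-- The energy lost by `-A` in passing through the factor `(s + ā) / (s - a)`. -/
theorem norm_sub_sq_of_lyapunov {A : X →L[ℂ] X} {C : X →L[ℂ] ℂ}
    (h : A + A.adjoint + C.adjoint ∘L C = 0) (a : ℂ) (z : X) :
    ‖(-A) z - a • z‖ ^ 2 = ‖(-A) z + conj a • z‖ ^ 2 + -2 * a.re * ‖C z‖ ^ 2 := by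
  have h1 := re_inner_of_lyapunov h z
  have h2 := @norm_sub_sq ℂ X _ _ _ ((-A) z) (a • z)
  have h3 := @norm_add_sq ℂ X _ _ _ ((-A) z) (conj a • z)
  rw [h2, h3, inner_smul_right, inner_smul_right, norm_smul, norm_smul, RCLike.norm_conj,
    neg_apply, inner_neg_left]
  have h4 : (⟪A z, z⟫_ℂ).re = (⟪z, A z⟫_ℂ).re := by rw [← inner_conj_symm, Complex.conj_re]
  simp [h4]
  linear_combination (2 * a.re) * h1

/-- A Blaschke product is contractive at `-A`; the energy lost in each factor is the square of the
modulus of one linear functional. -/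
theorem norm_num_le_norm_den {A : X →L[ℂ] X} {C : X →L[ℂ] ℂ}
    (h : A + A.adjoint + C.adjoint ∘L C = 0) (b : Blaschke) (y : X) :
    ‖Polynomial.aeval (-A) b.num y‖ ≤ ‖Polynomial.aeval (-A) b.den y‖ ∧
      (‖Polynomial.aeval (-A) b.num y‖ = ‖Polynomial.aeval (-A) b.den y‖ ↔
        y ∈ unobservable (-A) C b.deg) := by
  induction b using Blaschke.cons_induction generalizing y with
  | const ρ hρ =>
    have h1 : ‖Polynomial.aeval (-A) (Polynomial.C ρ) y‖ = ‖y‖ := by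
      rw [Polynomial.aeval_C, Algebra.algebraMap_eq_smul_one, smul_apply,
        one_apply_eq_self, norm_smul, hρ, one_mul]
    rw [Blaschke.num_const, Blaschke.den_const, map_one, one_apply_eq_self, h1]
    refine ⟨le_rfl, iff_of_true rfl fun q hq => ?_⟩
    have : q = 0 := by
      rw [← Polynomial.degree_eq_bot]
      exact Nat.WithBot.lt_zero_iff.1 hq
    simp [this]
  | cons a ha b ih =>
    set z := Polynomial.aeval (-A) b.den y with hz
    set y' := (-A) y - (-conj a) • y with hy'
    have hden : Polynomial.aeval (-A) ((Polynomial.X - Polynomial.C a) * b.den) y =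
        (-A) z - a • z := by
      simp [hz, Algebra.algebraMap_eq_smul_one]
    have hnum : Polynomial.aeval (-A) ((Polynomial.X + Polynomial.C (conj a)) * b.num) y =
        Polynomial.aeval (-A) b.num y' := by
      rw [mul_comm]
      simp [hy', Algebra.algebraMap_eq_smul_one]
    have hden' : Polynomial.aeval (-A) b.den y' = (-A) z + conj a • z := by
      have h1 : Polynomial.aeval (-A) ((Polynomial.X + Polynomial.C (conj a)) * b.den) y =
        Polynomial.aeval (-A) b.den y' := by
        rw [mul_comm]
        simp [hy', Algebra.algebraMap_eq_smul_one]
      rw [← h1]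
      simp [hz, Algebra.algebraMap_eq_smul_one]
    obtain ⟨h1, h2⟩ := ih y'
    have h3 := norm_sub_sq_of_lyapunov h a z
    rw [Blaschke.num_cons, Blaschke.den_cons, hnum, hden]
    change _ ∧ (_ ↔ y ∈ unobservable (-A) C (b.deg + 1))
    -- the first functional is `C den_b(-A)`, and `den_b` does not vanish at the zero `-ā` of the
    -- numerator of the new factor
    rw [mem_unobservable_succ b.degree_den (μ := -conj a)
      (b.den_eval_ne_zero (by simpa using ha.le)), ← hy', ← h2, ← hz]
    rw [hden'] at h1 h2 ⊢
    have h4 : 0 ≤ -2 * a.re * ‖C z‖ ^ 2 := by nlinarith [sq_nonneg ‖C z‖]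
    have h5 : ‖(-A) z + conj a • z‖ ≤ ‖(-A) z - a • z‖ :=
      le_of_sq_le_sq (by linarith) (norm_nonneg _)
    refine ⟨h1.trans h5, fun h6 => ?_, fun ⟨h6, h7⟩ => ?_⟩
    · have h7 : ‖(-A) z + conj a • z‖ = ‖(-A) z - a • z‖ := le_antisymm h5 (h6 ▸ h1)
      rw [h7] at h3
      have h8 : ‖C z‖ ^ 2 = 0 := by
        have h9 : -2 * a.re * ‖C z‖ ^ 2 = 0 := by linarith
        rcases mul_eq_zero.1 h9 with h10 | h10
        · linarith
        · exact h10
      exact ⟨by simpa using h8, by rw [h6, h7]⟩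
    · rw [h6, norm_zero] at h3
      have h8 : ‖(-A) z + conj a • z‖ ^ 2 = ‖(-A) z - a • z‖ ^ 2 := by linarith
      rw [h7]
      exact (sq_eq_sq₀ (norm_nonneg _) (norm_nonneg _)).1 h8

end Lyapunov

/-! ### Wiener-Hopf operators with inner symbol -/

theorem LinearMap.rank_comap_of_surjective.{u} {𝕜 : Type*} [Field 𝕜] {V W : Type u}
    [AddCommGroup V] [Module 𝕜 V] [AddCommGroup W] [Module 𝕜 W] {f : V →ₗ[𝕜] W}
    (hf : Function.Surjective f) (K : Submodule 𝕜 W) :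
    Module.rank 𝕜 (K.comap f) = Module.rank 𝕜 K + Module.rank 𝕜 (LinearMap.ker f) := by
  have hg : Function.Surjective (f.restrict (p := K.comap f) (q := K) fun x hx => hx) := by
    rintro ⟨y, hy⟩
    obtain ⟨x, rfl⟩ := hf y
    exact ⟨⟨x, hy⟩, rfl⟩
  rw [LinearMap.rank_eq_of_surjective hg, LinearMap.ker_restrict]
  congr 1
  refine (Submodule.comapSubtypeEquivOfLe (p := LinearMap.ker f) (q := K.comap f) ?_).rank_eq
  intro x hx
  rw [Submodule.mem_comap, LinearMap.mem_ker.1 hx]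
  exact zero_mem _

namespace Blaschke

/-- The Wiener-Hopf operator `T_b` as a bounded operator. Its graph is closed because the Laplace
transform of `T_b f` is `b` times that of `f`. -/
noncomputable def multOp (b : Blaschke) : LTwoPlus →L[ℂ] LTwoPlus where
  toLinearMap := b.wienerHopfOp
  cont := by
    refine b.wienerHopfOp.continuous_of_seq_closed_graph fun u x y hu hy => ?_
    refine ext_inner_expVec one_pos fun s hs => ?_
    have hs : 0 < s.re := hs ▸ one_pos
    rw [inner_expVec_wienerHopfOp b hs]
    have h1 := (tendsto_const_nhds (x := expVec s)).inner (𝕜 := ℂ) hy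
    simp only [Function.comp_apply, inner_expVec_wienerHopfOp b hs] at h1
    exact tendsto_nhds_unique h1 (((tendsto_const_nhds (x := expVec s)).inner hu).const_mul _)

theorem inner_expVec_multOp (b : Blaschke) {s : ℂ} (hs : 0 < s.re) (f : LTwoPlus) :
    ⟪expVec s, b.multOp f⟫_ℂ = b.toFun s * ⟪expVec s, f⟫_ℂ :=
  inner_expVec_wienerHopfOp b hs f

theorem adjoint_multOp_expVec (b : Blaschke) {s : ℂ} (hs : 0 < s.re) :
    b.multOp.adjoint (expVec s) = conj (b.toFun s) • expVec s := by
  refine ext_inner_right ℂ fun f => ?_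
  rw [ContinuousLinearMap.adjoint_inner_left, inner_expVec_multOp b hs, inner_smul_left,
    Complex.conj_conj]

theorem modelSpace_eq_ker (b : Blaschke) :
    b.modelSpace = LinearMap.ker (b.multOp.adjoint : LTwoPlus →ₗ[ℂ] LTwoPlus) :=
  b.multOp.orthogonal_range

theorem multOp_const (ρ : ℂ) (hρ : ‖ρ‖ = 1) : (const ρ hρ).multOp = ρ • 1 := by
  ext1 f
  refine ext_inner_expVec one_pos fun s hs => ?_
  rw [inner_expVec_multOp _ (hs ▸ one_pos), toFun_const, smul_apply, inner_smul_right,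
    one_apply_eq_self]

theorem adjoint_multOp_const (ρ : ℂ) (hρ : ‖ρ‖ = 1) :
    (const ρ hρ).multOp.adjoint = conj ρ • 1 := by
  rw [multOp_const, map_smulₛₗ, ← ContinuousLinearMap.star_eq_adjoint, star_one]

/-- The Blaschke factor `(s + ā) / (s - a)`. -/
noncomputable def factor (a : ℂ) (ha : a.re < 0) : Blaschke := cons a ha (const 1 norm_one)

theorem toFun_factor (a : ℂ) (ha : a.re < 0) (s : ℂ) :
    (factor a ha).toFun s = (s + conj a) / (s - a) := by
  rw [factor, toFun_cons, toFun_const, mul_one]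

theorem multOp_cons (a : ℂ) (ha : a.re < 0) (b : Blaschke) :
    (cons a ha b).multOp = (factor a ha).multOp ∘L b.multOp := by
  ext1 f
  refine ext_inner_expVec one_pos fun s hs => ?_
  have hs : 0 < s.re := hs ▸ one_pos
  rw [inner_expVec_multOp _ hs, ContinuousLinearMap.comp_apply, inner_expVec_multOp _ hs,
    inner_expVec_multOp _ hs, toFun_cons, toFun_factor, mul_assoc]

/-- The partial fraction decomposition of `(s + ā) / ((s - a) (s + w̄))`. -/
theorem multOp_factor_expVec (a : ℂ) (ha : a.re < 0) {w : ℂ} (hw : 0 < w.re)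
    (hwa : w + conj a ≠ 0) :
    (factor a ha).multOp (expVec w) =
      conj ((w - a) / (w + conj a)) • expVec w +
        conj ((a + conj a) / (w + conj a)) • expVec (-conj a) := by
  have h1 : conj w + a ≠ 0 := fun h => hwa (by simpa using congrArg conj h)
  refine ext_inner_expVec one_pos fun s hs => ?_
  have hs : 0 < s.re := hs ▸ one_pos
  have ha' : 0 < (-conj a).re := by simpa using ha
  have h2 : s - a ≠ 0 := fun h => by
    have := congrArg Complex.re h
    simp at this; linarith
  have h3 : s + conj w ≠ 0 := fun h => by
    have := congrArg Complex.re h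
    simp at this; linarith
  rw [inner_expVec_multOp _ hs, toFun_factor, inner_add_right, inner_smul_right, inner_smul_right,
    inner_expVec_expVec hs hw, inner_expVec_expVec hs ha']
  simp only [map_neg, Complex.conj_conj, map_div₀, map_sub, map_add, ← sub_eq_add_neg]
  field_simp
  ring

/-- A single factor is isometric: the adjoint multiplies `expVec w` by `conj (b(w))`, the inverse of
its coefficient in `T_b (expVec w)`, and annihilates `expVec (-ā)`, as `-ā` is the zero of `b`. -/
theorem adjoint_factor_comp (a : ℂ) (ha : a.re < 0) :
    (factor a ha).multOp.adjoint ∘L (factor a ha).multOp = 1 := by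
  ext1 f
  -- a vertical line that avoids `-ā`, where the two exponentials in `multOp_factor_expVec` coincide
  refine ext_inner_expVec (c := -a.re + 1) (by linarith) fun w hwc => ?_
  have hw : 0 < w.re := by linarith
  have hwa : w + conj a ≠ 0 := fun h => by
    have := congrArg Complex.re h
    simp at this; linarith
  have h4 : w - a ≠ 0 := fun h => by
    have := congrArg Complex.re h
    simp at this; linarith
  have ha' : 0 < (-conj a).re := by simpa using ha
  have h1 : (factor a ha).multOp.adjoint ((factor a ha).multOp (expVec w)) = expVec w := by
    rw [multOp_factor_expVec a ha hw hwa, map_add, map_smul, map_smul, adjoint_multOp_expVec _ hw,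
      adjoint_multOp_expVec _ ha', toFun_factor, toFun_factor, neg_add_cancel, zero_div, map_zero,
      zero_smul, smul_zero, add_zero, smul_smul, ← map_mul, div_mul_div_comm, mul_comm,
      div_self (mul_ne_zero hwa h4), map_one, one_smul]
  rw [ContinuousLinearMap.comp_apply, ContinuousLinearMap.adjoint_inner_right,
    ← ContinuousLinearMap.adjoint_inner_left, h1, one_apply_eq_self]

/-- Multiplication by a Blaschke product is isometric. -/
theorem adjoint_comp_multOp (b : Blaschke) : b.multOp.adjoint ∘L b.multOp = 1 := by
  induction b using cons_induction with
  | const ρ hρ =>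
    ext1 f
    rw [adjoint_multOp_const, multOp_const, ContinuousLinearMap.comp_apply, smul_apply, smul_apply,
      one_apply_eq_self, one_apply_eq_self, smul_smul, Complex.conj_mul', hρ, Complex.ofReal_one,
      one_pow, one_smul]
  | cons a ha b ih =>
    rw [multOp_cons, ContinuousLinearMap.adjoint_comp, ContinuousLinearMap.comp_assoc,
      ← ContinuousLinearMap.comp_assoc _ _ b.multOp, adjoint_factor_comp]
    exact ih

theorem adjoint_multOp_multOp (b : Blaschke) (f : LTwoPlus) : b.multOp.adjoint (b.multOp f) = f :=
  congrArg (fun T : LTwoPlus →L[ℂ] LTwoPlus => T f) b.adjoint_comp_multOp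

theorem ker_adjoint_factor (a : ℂ) (ha : a.re < 0) :
    LinearMap.ker ((factor a ha).multOp.adjoint : LTwoPlus →ₗ[ℂ] LTwoPlus) =
      ℂ ∙ expVec (-conj a) := by
  have ha' : 0 < (-conj a).re := by simpa using ha
  refine le_antisymm (fun f hf => ?_) ?_
  · rw [Submodule.mem_span_singleton]
    -- the coefficient of the projection, as `‖expVec (-ā)‖² = -1 / (a + ā)`
    refine ⟨-(a + conj a) * ⟪expVec (-conj a), f⟫_ℂ, ?_⟩
    refine ext_inner_expVec (c := -a.re + 1) (by linarith) fun w hwc => ?_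
    have hw : 0 < w.re := by linarith
    have hwa : w + conj a ≠ 0 := fun h => by
      have := congrArg Complex.re h
      simp at this; linarith
    have h4 : w - a ≠ 0 := fun h => by
      have := congrArg Complex.re h
      simp at this; linarith
    have h1 : ⟪expVec w, (factor a ha).multOp.adjoint f⟫_ℂ = 0 := by
      rw [show (factor a ha).multOp.adjoint f = 0 from hf, inner_zero_right]
    rw [ContinuousLinearMap.adjoint_inner_right, multOp_factor_expVec a ha hw hwa, inner_add_left,
      inner_smul_left, inner_smul_left, Complex.conj_conj, Complex.conj_conj] at h1
    rw [inner_smul_right, inner_expVec_expVec hw ha']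
    simp only [map_neg, Complex.conj_conj, ← sub_eq_add_neg]
    field_simp at h1 ⊢
    linear_combination -h1
  · rw [Submodule.span_singleton_le_iff_mem, LinearMap.mem_ker]
    change (factor a ha).multOp.adjoint _ = 0
    rw [adjoint_multOp_expVec _ ha', toFun_factor, neg_add_cancel, zero_div, map_zero, zero_smul]

/-- The model space of a Blaschke product has dimension equal to the degree: `T_b†` is surjective,
so the kernels of the factors add up. -/
theorem rank_modelSpace (b : Blaschke) : Module.rank ℂ b.modelSpace = b.deg := by
  rw [modelSpace_eq_ker]
  induction b using cons_induction with
  | const ρ hρ =>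
    have h : LinearMap.ker ((const ρ hρ).multOp.adjoint : LTwoPlus →ₗ[ℂ] LTwoPlus) = ⊥ := by
      rw [eq_bot_iff]
      intro f hf
      have h1 : (const ρ hρ).multOp.adjoint f = 0 := hf
      rw [adjoint_multOp_const, smul_apply, one_apply_eq_self, smul_eq_zero, map_eq_zero,
        ← norm_eq_zero, hρ] at h1
      exact h1.resolve_left one_ne_zero
    rw [h, rank_bot, deg_const, Nat.cast_zero]
  | cons a ha b ih =>
    have h : LinearMap.ker ((cons a ha b).multOp.adjoint : LTwoPlus →ₗ[ℂ] LTwoPlus) =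
        (LinearMap.ker (b.multOp.adjoint : LTwoPlus →ₗ[ℂ] LTwoPlus)).comap
          ((factor a ha).multOp.adjoint : LTwoPlus →ₗ[ℂ] LTwoPlus) := by
      rw [multOp_cons, ContinuousLinearMap.adjoint_comp, ContinuousLinearMap.toLinearMap_comp,
        LinearMap.ker_comp]
    have hsurj : Function.Surjective (factor a ha).multOp.adjoint := fun f =>
      ⟨(factor a ha).multOp f, adjoint_multOp_multOp _ f⟩
    have ha' : 0 < (-conj a).re := by simpa using ha
    have h0 : expVec (-conj a) ≠ 0 := by
      intro h0
      have h1 := inner_expVec_expVec ha' ha'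
      rw [h0, inner_zero_left] at h1
      have h2 := congrArg Complex.re ((div_eq_zero_iff.1 h1.symm).resolve_left one_ne_zero)
      simp at h2
      linarith
    rw [h, LinearMap.rank_comap_of_surjective hsurj, ih, ker_adjoint_factor,
      ← Module.finrank_eq_rank, finrank_span_singleton h0,
      Nat.cast_one, deg_cons, Nat.cast_succ]

instance (b : Blaschke) : FiniteDimensional ℂ b.modelSpace :=
  Module.rank_lt_aleph0_iff.1 (b.rank_modelSpace ▸ Cardinal.natCast_lt_aleph0)

theorem finrank_modelSpace (b : Blaschke) : Module.finrank ℂ b.modelSpace = b.deg := by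
  rw [Module.finrank, b.rank_modelSpace, Cardinal.toNat_natCast]

theorem orthogonalProjectionOnto_modelSpace (b : Blaschke) (f : LTwoPlus) :
    (b.modelSpace.orthogonalProjectionOnto f : LTwoPlus) = f - b.multOp (b.multOp.adjoint f) := by
  refine Submodule.eq_starProjection_of_mem_of_inner_eq_zero ?_ fun g hg => ?_
  · rw [modelSpace_eq_ker, LinearMap.mem_ker]
    change b.multOp.adjoint _ = 0
    rw [map_sub, adjoint_multOp_multOp, sub_self]
  · rw [modelSpace_eq_ker] at hg
    rw [sub_sub_cancel, ← ContinuousLinearMap.adjoint_inner_right,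
      show b.multOp.adjoint g = 0 from hg, inner_zero_right]

theorem norm_sq_orthogonalProjectionOnto_modelSpace (b : Blaschke) (f : LTwoPlus) :
    ‖b.modelSpace.orthogonalProjectionOnto f‖ ^ 2 = ‖f‖ ^ 2 - ‖b.multOp.adjoint f‖ ^ 2 := by
  rw [← Submodule.norm_coe, orthogonalProjectionOnto_modelSpace, @norm_sub_sq ℂ,
    ← ContinuousLinearMap.adjoint_inner_left, inner_self_eq_norm_sq]
  have h : ‖b.multOp (b.multOp.adjoint f)‖ ^ 2 = ‖b.multOp.adjoint f‖ ^ 2 := by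
    rw [← inner_self_eq_norm_sq (𝕜 := ℂ), ← ContinuousLinearMap.adjoint_inner_left,
      adjoint_multOp_multOp, inner_self_eq_norm_sq]
  rw [h]; ring

end Blaschke

/-! ### The observability operator -/

section Observability

open Blaschke

variable {X : Type*} [NormedAddCommGroup X] [InnerProductSpace ℂ X] [CompleteSpace X]

/-- `T_b† Γ = Γ b̃(-A)` for the factor `b(s) = (s + ā) / (s - a)`, with the denominator of `b̃`
cleared. -/
theorem adjoint_factor_observability {A : X →L[ℂ] X} {C : X →L[ℂ] ℂ}
    (h : A + A.adjoint + C.adjoint ∘L C = 0) (hA : ∀ s : ℂ, 0 ≤ s.re → s ∈ resolventSet ℂ A)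
    (a : ℂ) (ha : a.re < 0) (y : X) :
    (factor a ha).multOp.adjoint (observability h (-conj a • y - A y)) =
      observability h (a • y - A y) := by
  refine ext_inner_expVec (c := -a.re + 1) (by linarith) fun w hwc => ?_
  have hw : 0 < w.re := by linarith
  have hwa : w + conj a ≠ 0 := fun h => by
    have := congrArg Complex.re h
    simp at this; linarith
  have ha' : 0 < (-conj a).re := by simpa using ha
  rw [ContinuousLinearMap.adjoint_inner_right, multOp_factor_expVec a ha hw hwa, inner_add_left,
    inner_smul_left, inner_smul_left, Complex.conj_conj, Complex.conj_conj,
    inner_expVec_observability h hw (hA _ hw.le), inner_expVec_observability h hw (hA _ hw.le),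
    inner_expVec_observability h ha' (hA _ ha'.le), resolvent_apply_sub (hA _ ha'.le)]
  -- shift both arguments by multiples of `w • y - A y`, which the resolvent at `w` sends to `y`
  have h1 : -conj a • y - A y = (w • y - A y) - (w + conj a) • y := by module
  have h2 : a • y - A y = (w • y - A y) - (w - a) • y := by module
  rw [h1, h2]
  simp only [map_sub, map_smul, resolvent_apply_sub (hA _ hw.le), smul_eq_mul]
  field_simp
  ring

theorem adjoint_multOp_observability_den {A : X →L[ℂ] X} {C : X →L[ℂ] ℂ}
    (h : A + A.adjoint + C.adjoint ∘L C = 0) (hA : ∀ s : ℂ, 0 ≤ s.re → s ∈ resolventSet ℂ A)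
    (b : Blaschke) (y : X) :
    b.multOp.adjoint (observability h (Polynomial.aeval (-A) b.tilde.den y)) =
      observability h (Polynomial.aeval (-A) b.tilde.num y) := by
  induction b using cons_induction generalizing y with
  | const ρ hρ =>
    rw [adjoint_multOp_const, tilde_const, den_const, num_const, map_one, Polynomial.aeval_C,
      Algebra.algebraMap_eq_smul_one]
    simp
  | cons a ha b ih =>
    have hden : Polynomial.aeval (-A) ((Polynomial.X - Polynomial.C (conj a)) * b.tilde.den) y =
        -conj a • (Polynomial.aeval (-A) b.tilde.den y) -
          A (Polynomial.aeval (-A) b.tilde.den y) := by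
      simp [Algebra.algebraMap_eq_smul_one]
      abel
    have hnum : ∀ p : ℂ[X], Polynomial.aeval (-A) ((Polynomial.X + Polynomial.C a) * p) y =
        Polynomial.aeval (-A) p (a • y - A y) := by
      intro p
      rw [mul_comm]
      simp [Algebra.algebraMap_eq_smul_one, sub_eq_neg_add]
    have hnum' : a • (Polynomial.aeval (-A) b.tilde.den y) -
          A (Polynomial.aeval (-A) b.tilde.den y) =
        Polynomial.aeval (-A) b.tilde.den (a • y - A y) := by
      rw [← hnum]
      simp [Algebra.algebraMap_eq_smul_one, sub_eq_neg_add]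
    rw [multOp_cons, ContinuousLinearMap.adjoint_comp, ContinuousLinearMap.comp_apply, tilde_cons,
      den_cons, num_cons, Complex.conj_conj, hden, adjoint_factor_observability h hA, hnum', ih,
      hnum]

/-- The adjoint of `T_b` acts on the range of the observability operator as `b̃(-A)` does on the
state space. -/
theorem adjoint_multOp_observability {A : X →L[ℂ] X} {C : X →L[ℂ] ℂ}
    (h : A + A.adjoint + C.adjoint ∘L C = 0) (hA : ∀ s : ℂ, 0 ≤ s.re → s ∈ resolventSet ℂ A)
    (b : Blaschke) (x : X) :
    b.multOp.adjoint (observability h x) = observability h (b.tilde.evalOp (-A) x) := by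
  obtain ⟨y, rfl⟩ := exists_aeval_den_eq hA b.tilde x
  rw [evalOp_aeval_den hA, adjoint_multOp_observability_den h hA]

end Observability

/-! ### Stable dissipative realizations -/

section Observable

open Blaschke

variable {X : Type*} [NormedAddCommGroup X] [InnerProductSpace ℂ X] [CompleteSpace X]

/-- An eigenvector of `A` annihilated by `C` would belong, by the Lyapunov equation, to a purely
imaginary eigenvalue. -/
theorem eq_bot_of_invariant [FiniteDimensional ℂ X] {A : X →L[ℂ] X} {C : X →L[ℂ] ℂ}
    (h : A + A.adjoint + C.adjoint ∘L C = 0)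
    (hA : ∀ z : ℂ, Module.End.HasEigenvalue (A : X →ₗ[ℂ] X) z → z.re < 0)
    {W : Submodule ℂ X} (hW : ∀ x ∈ W, A x ∈ W) (hC : ∀ x ∈ W, C x = 0) : W = ⊥ := by
  by_contra hne
  have : Nontrivial W := Submodule.nontrivial_iff_ne_bot.2 hne
  obtain ⟨μ, hμ⟩ := Module.End.exists_eigenvalue ((A : X →ₗ[ℂ] X).restrict hW)
  obtain ⟨⟨x, hx⟩, hxμ⟩ := hμ.exists_hasEigenvector
  have h0 : x ≠ 0 := fun h0 => hxμ.2 (Subtype.ext h0)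
  have h1 : A x = μ • x := congrArg Subtype.val hxμ.apply_eq_smul
  have h2 := hA μ (Module.End.hasEigenvalue_of_hasEigenvector (Module.End.hasEigenvector_iff.2
      ⟨Module.End.mem_eigenspace_iff.2 h1, h0⟩))
  have h3 := re_inner_of_lyapunov h x
  rw [h1, hC x hx, inner_smul_right, inner_self_eq_norm_sq_to_K] at h3
  have h4 : (μ * (RCLike.ofReal ‖x‖ : ℂ) ^ 2).re = μ.re * ‖x‖ ^ 2 := by
    rw [← RCLike.ofReal_pow]; exact Complex.re_mul_ofReal _ _
  rw [h4] at h3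
  have h5 : 0 < ‖x‖ ^ 2 := by positivity
  have h6 := mul_neg_of_neg_of_pos h2 h5
  simp at h3
  rcases h3 with h3 | h3
  · linarith
  · exact h0 h3

theorem eq_zero_of_forall_aeval [FiniteDimensional ℂ X] {A : X →L[ℂ] X} {C : X →L[ℂ] ℂ}
    (h : A + A.adjoint + C.adjoint ∘L C = 0)
    (hA : ∀ z : ℂ, Module.End.HasEigenvalue (A : X →ₗ[ℂ] X) z → z.re < 0)
    (y : X) (hy : ∀ q : ℂ[X], C (Polynomial.aeval (-A) q y) = 0) : y = 0 := by
  have hW : (⨅ n, unobservable (-A) C n) = ⊥ := by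
    have hmem : ∀ x, x ∈ (⨅ n, unobservable (-A) C n) ↔
        ∀ q : ℂ[X], C (Polynomial.aeval (-A) q x) = 0 := by
      intro x
      rw [Submodule.mem_iInf]
      refine ⟨fun hx q => hx (q.natDegree + 1) q ?_, fun hx n q _ => hx q⟩
      exact Polynomial.degree_le_natDegree.trans_lt (by exact_mod_cast Nat.lt_succ_self _)
    refine eq_bot_of_invariant h hA (fun x hx => ?_) fun x hx => ?_
    · rw [hmem] at hx ⊢
      intro q
      have := hx (q * -Polynomial.X)
      simpa using this
    · have := (hmem x).1 hx 1
      simpa using this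
  have : y ∈ (⨅ n, unobservable (-A) C n) :=
    (Submodule.mem_iInf _).2 fun n q _ => hy q
  simpa [hW] using this

/-- If `C (s - A)⁻¹ x` vanishes identically, then `C (s - A)⁻¹ A x = -C x` is a constant Laplace
transform, hence `0`, because the norm of `expVec s` tends to `0`. -/
theorem observability_injective [FiniteDimensional ℂ X] {A : X →L[ℂ] X} {C : X →L[ℂ] ℂ}
    (h : A + A.adjoint + C.adjoint ∘L C = 0)
    (hA : ∀ z : ℂ, Module.End.HasEigenvalue (A : X →ₗ[ℂ] X) z → z.re < 0) :
    Function.Injective (observability h) := by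
  have hρ : ∀ s : ℂ, 0 ≤ s.re → s ∈ resolventSet ℂ A := fun s => mem_resolventSet_of_stable hA
  have key : ∀ x, observability h x = 0 → ∀ s : ℂ, 0 < s.re →
      ⟪expVec s, observability h (A x)⟫_ℂ = -C x := by
    intro x hx s hs
    have h1 := inner_expVec_observability h hs (hρ s hs.le) x
    rw [hx, inner_zero_right] at h1
    rw [inner_expVec_observability h hs (hρ s hs.le),
      show A x = s • x - (s • x - A x) by abel, map_sub, map_sub,
      resolvent_apply_sub (hρ s hs.le), map_smul, map_smul, ← h1, smul_zero, zero_sub]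
  have hC : ∀ x, observability h x = 0 → C x = 0 := by
    intro x hx
    by_contra hne
    have hpos : 0 < ‖C x‖ ^ 2 := by positivity
    set K := ‖observability h (A x)‖ ^ 2 with hK
    have hK0 : 0 ≤ K := sq_nonneg _
    set r : ℝ := (K + 1) / ‖C x‖ ^ 2 with hr
    have hr0 : 0 < r := by positivity
    have hs : 0 < (r : ℂ).re := hr0
    have h1 := norm_inner_le_norm (𝕜 := ℂ) (expVec r) (observability h (A x))
    rw [key x hx r hs, norm_neg] at h1
    have h2 : ‖expVec r‖ ^ 2 = 1 / (r + r) := by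
      have h3 := inner_expVec_expVec hs hs
      rw [inner_self_eq_norm_sq_to_K, Complex.conj_ofReal] at h3
      have h4 : ((‖expVec r‖ ^ 2 : ℝ) : ℂ) = ((1 / (r + r) : ℝ) : ℂ) := by
        push_cast; exact h3
      exact_mod_cast h4
    have h3 : ‖C x‖ ^ 2 ≤ 1 / (r + r) * K := by
      rw [← h2, hK, ← mul_pow]
      exact pow_le_pow_left₀ (norm_nonneg _) h1 2
    have h4 : ‖C x‖ ^ 2 * (r + r) ≤ K := by
      rwa [div_mul_eq_mul_div, one_mul, le_div_iff₀ (by positivity)] at h3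
    have h5 : ‖C x‖ ^ 2 * r = K + 1 := by rw [hr]; field_simp
    linarith
  refine LinearMap.ker_eq_bot.1 (eq_bot_of_invariant h hA (fun x hx => ?_) fun x hx => hC x hx)
  rw [LinearMap.mem_ker] at hx ⊢
  refine eq_zero_of_inner_expVec one_pos fun s hs => ?_
  rw [key x hx s (hs ▸ one_pos), hC x hx, neg_zero]

/-- For a stable dissipative realization of `m`, the operator `Γ Γ†` is the orthogonal projection
onto the model space: both sides have the kernel `(1 - m(s) conj m(w)) / (s + w̄)`. -/
theorem observability_comp_adjoint [FiniteDimensional ℂ X] {m : Blaschke} {A : X →L[ℂ] X}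
    {B : ℂ →L[ℂ] X} {C : X →L[ℂ] ℂ} {D : ℂ →L[ℂ] ℂ} (hABCD : IsStableDissipative A B C D)
    (hm : IsRealization m.toFun A B C D) (f : LTwoPlus) :
    observability hABCD.lyapunov
      ((LinearMap.toContinuousLinearMap (observability hABCD.lyapunov)).adjoint f) =
      f - m.multOp (m.multOp.adjoint f) := by
  set G := LinearMap.toContinuousLinearMap (observability hABCD.lyapunov) with hG
  have hρ : ∀ s : ℂ, 0 ≤ s.re → s ∈ resolventSet ℂ A := fun s =>
    mem_resolventSet_of_stable hABCD.stable
  have hR : ∀ s : ℂ, 0 < s.re → ∀ x, ⟪expVec s, G x⟫_ℂ = C (resolvent A s x) := fun s hs x =>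
    inner_expVec_observability hABCD.lyapunov hs (hρ s hs.le) x
  set c : X := C.adjoint 1 with hc
  set d : ℂ := D 1 with hd
  have hd1 : d * conj d = 1 := by
    have h1 : D.adjoint (D 1) = 1 :=
      congrArg (fun T : ℂ →L[ℂ] ℂ => T 1) (Unitary.star_mul_self_of_mem hABCD.unitary_D)
    have h2 : ⟪D 1, D 1⟫_ℂ = ⟪(1 : ℂ), 1⟫_ℂ := by
      rw [← ContinuousLinearMap.adjoint_inner_right, h1]
    simpa only [RCLike.inner_apply, map_one, mul_one] using h2
  have hB : B 1 = -(d • c) := by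
    rw [hABCD.input_eq, neg_apply, ContinuousLinearMap.comp_apply, hc, ← map_smul, smul_eq_mul,
      mul_one]
  have hms : ∀ s : ℂ, 0 < s.re → m.toFun s = d * (1 - C (resolvent A s c)) := by
    intro s hs
    rw [hm s hs, hB, map_neg, map_neg, map_smul, map_smul, smul_eq_mul]
    ring
  have key : ∀ w : ℂ, 0 < w.re →
      G (G.adjoint (expVec w)) = expVec w - m.multOp (m.multOp.adjoint (expVec w)) := by
    intro w hw
    set z := G.adjoint (expVec w) with hz
    have hzx : ∀ x, ⟪z, x⟫_ℂ = C (resolvent A w x) := fun x => by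
      rw [hz, ContinuousLinearMap.adjoint_inner_left, hR w hw]
    have hz1 : conj w • z - A.adjoint z = c := by
      refine ext_inner_right ℂ fun x => ?_
      rw [inner_sub_left, inner_smul_left, Complex.conj_conj,
        ContinuousLinearMap.adjoint_inner_left A, ← inner_smul_right, ← inner_sub_right, hzx,
        resolvent_apply_sub (hρ w hw.le), hc, ContinuousLinearMap.adjoint_inner_left]
      simp [RCLike.inner_apply]
    have hCz : conj (C (resolvent A w c)) = C z := by
      rw [← hzx, inner_conj_symm, hc, ContinuousLinearMap.adjoint_inner_left]
      simp [RCLike.inner_apply]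
    have hz2 : A z + A.adjoint z + C z • c = 0 := by
      have := congrArg (fun T : X →L[ℂ] X => T z) hABCD.lyapunov
      rw [hc, ← map_smul, smul_eq_mul, mul_one]
      exact this
    refine ext_inner_expVec one_pos fun s hs => ?_
    have hs : 0 < s.re := hs ▸ one_pos
    -- with `z = (w̄ - A†)⁻¹ c`, the Lyapunov equation evaluates `C (s - A)⁻¹ z`
    have h3 : s + conj w ≠ 0 := fun h => by
      have := congrArg Complex.re h
      simp at this; linarith
    have hz3 : C z • c = (s • z - A z) - (s + conj w) • z + c := by
      linear_combination (norm := module) hz2 + hz1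
    have hz4 : C z * C (resolvent A s c) =
        C z - (s + conj w) * C (resolvent A s z) + C (resolvent A s c) := by
      have := congrArg (fun x => C (resolvent A s x)) hz3
      rwa [map_smul, map_smul, map_add, map_sub (resolvent A s) (s • z - A z), map_add,
        resolvent_apply_sub (hρ s hs.le), map_sub C, map_smul, map_smul] at this
    rw [hR s hs, inner_sub_right, inner_expVec_multOp _ hs, adjoint_multOp_expVec _ hw,
      inner_smul_right, inner_expVec_expVec hs hw, hms s hs, hms w hw, map_mul, map_sub, map_one,
      hCz]
    field_simp
    linear_combination (1 - C (resolvent A s c)) * (1 - C z) * hd1 + hz4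
  change G (G.adjoint f) = _
  refine ext_inner_expVec one_pos fun w hw => ?_
  have hw : 0 < w.re := hw ▸ one_pos
  have h1 : ⟪expVec w, G (G.adjoint f)⟫_ℂ = ⟪G (G.adjoint (expVec w)), f⟫_ℂ := by
    rw [← ContinuousLinearMap.adjoint_inner_left, ContinuousLinearMap.adjoint_inner_right]
  rw [h1, key w hw, inner_sub_left, inner_sub_right, ← ContinuousLinearMap.adjoint_inner_right,
    ContinuousLinearMap.adjoint_inner_left]

theorem adjoint_observability_comp [FiniteDimensional ℂ X] {m : Blaschke} {A : X →L[ℂ] X}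
    {B : ℂ →L[ℂ] X} {C : X →L[ℂ] ℂ} {D : ℂ →L[ℂ] ℂ} (hABCD : IsStableDissipative A B C D)
    (hm : IsRealization m.toFun A B C D) (x : X) :
    (LinearMap.toContinuousLinearMap (observability hABCD.lyapunov)).adjoint
      (observability hABCD.lyapunov x) = x := by
  have hGG := observability_comp_adjoint hABCD hm
  have hinj := observability_injective hABCD.lyapunov hABCD.stable
  set G := LinearMap.toContinuousLinearMap (observability hABCD.lyapunov) with hG
  change ∀ f, G (G.adjoint f) = _ at hGG
  change Function.Injective G at hinj
  have h1 : ∀ f, G.adjoint (G (G.adjoint f)) = G.adjoint f := fun f => hinj (by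
    rw [hGG (G (G.adjoint f)), hGG f, map_sub m.multOp.adjoint, adjoint_multOp_multOp, sub_self,
      map_zero, sub_zero])
  refine hinj (ext_inner_left ℂ fun f => ?_)
  change ⟪f, G (G.adjoint (G x))⟫_ℂ = ⟪f, G x⟫_ℂ
  rw [← ContinuousLinearMap.adjoint_inner_left, ContinuousLinearMap.adjoint_inner_right,
    ← ContinuousLinearMap.adjoint_inner_left, h1, ContinuousLinearMap.adjoint_inner_left]

/-- The observability operator is isometric, being injective with `Γ Γ†` idempotent. -/
theorem norm_observability [FiniteDimensional ℂ X] {m : Blaschke} {A : X →L[ℂ] X}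
    {B : ℂ →L[ℂ] X} {C : X →L[ℂ] ℂ} {D : ℂ →L[ℂ] ℂ} (hABCD : IsStableDissipative A B C D)
    (hm : IsRealization m.toFun A B C D) (x : X) :
    ‖observability hABCD.lyapunov x‖ = ‖x‖ := by
  have h := adjoint_observability_comp hABCD hm x
  set G := LinearMap.toContinuousLinearMap (observability hABCD.lyapunov) with hG
  change G.adjoint (G x) = x at h
  change ‖G x‖ = ‖x‖
  rw [← sq_eq_sq₀ (norm_nonneg _) (norm_nonneg _), ← inner_self_eq_norm_sq (𝕜 := ℂ),
    ← ContinuousLinearMap.adjoint_inner_right, h, inner_self_eq_norm_sq]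

theorem range_observability [FiniteDimensional ℂ X] {m : Blaschke} {A : X →L[ℂ] X}
    {B : ℂ →L[ℂ] X} {C : X →L[ℂ] ℂ} {D : ℂ →L[ℂ] ℂ} (hABCD : IsStableDissipative A B C D)
    (hm : IsRealization m.toFun A B C D) :
    LinearMap.range (observability hABCD.lyapunov) = m.modelSpace := by
  have hGG := observability_comp_adjoint hABCD hm
  refine le_antisymm ?_ fun f hf => ?_
  · rintro _ ⟨x, rfl⟩
    have h1 := hGG (observability hABCD.lyapunov x)
    rw [adjoint_observability_comp hABCD hm, eq_comm, sub_eq_self] at h1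
    rw [modelSpace_eq_ker, LinearMap.mem_ker]
    change m.multOp.adjoint _ = 0
    rw [← adjoint_multOp_multOp m (m.multOp.adjoint _), h1, map_zero]
  · rw [modelSpace_eq_ker] at hf
    refine ⟨_, (hGG f).trans ?_⟩
    rw [show m.multOp.adjoint f = 0 from hf, map_zero, sub_zero]

theorem finrank_eq_deg [FiniteDimensional ℂ X] {m : Blaschke} {A : X →L[ℂ] X}
    {B : ℂ →L[ℂ] X} {C : X →L[ℂ] ℂ} {D : ℂ →L[ℂ] ℂ} (hABCD : IsStableDissipative A B C D)
    (hm : IsRealization m.toFun A B C D) : Module.finrank ℂ X = m.deg := by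
  rw [← finrank_modelSpace, ← range_observability hABCD hm]
  exact (LinearMap.finrank_range_of_inj
    (observability_injective hABCD.lyapunov hABCD.stable)).symm

end Observable

/-! ### Defect operators -/

section Defect

variable {X : Type*} [NormedAddCommGroup X] [InnerProductSpace ℂ X] [CompleteSpace X]

theorem isSelfAdjoint_defectOp (T : X →L[ℂ] X) : IsSelfAdjoint (defectOp T) :=
  (CFC.sqrt_nonneg _).isSelfAdjoint

theorem norm_sq_defectOp {T : X →L[ℂ] X} (hT : ‖T‖ ≤ 1) (x : X) :
    ‖defectOp T x‖ ^ 2 = ‖x‖ ^ 2 - ‖T x‖ ^ 2 := by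
  have hin : ∀ y, ⟪(1 - T.adjoint * T) y, y⟫_ℂ = ((‖y‖ ^ 2 - ‖T y‖ ^ 2 : ℝ) : ℂ) := by
    intro y
    rw [sub_apply, one_apply_eq_self, mul_apply_eq_comp, inner_sub_left,
      ContinuousLinearMap.adjoint_inner_left, inner_self_eq_norm_sq_to_K,
      inner_self_eq_norm_sq_to_K]
    push_cast
    rfl
  have hpos : 0 ≤ 1 - T.adjoint * T := by
    rw [ContinuousLinearMap.nonneg_iff_isPositive, ContinuousLinearMap.isPositive_iff_complex]
    intro y
    rw [hin]
    refine ⟨rfl, ?_⟩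
    have h1 : ‖T y‖ ≤ ‖y‖ := (T.le_of_opNorm_le hT y).trans_eq (one_mul _)
    have h2 : ‖T y‖ ^ 2 ≤ ‖y‖ ^ 2 := pow_le_pow_left₀ (norm_nonneg _) h1 2
    exact sub_nonneg.2 h2
  have hsq : defectOp T * defectOp T = 1 - T.adjoint * T := CFC.sqrt_mul_sqrt_self _ hpos
  have hadj : (defectOp T).adjoint = defectOp T := isSelfAdjoint_defectOp T
  have h1 : ((‖defectOp T x‖ ^ 2 : ℝ) : ℂ) = ((‖x‖ ^ 2 - ‖T x‖ ^ 2 : ℝ) : ℂ) := by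
    rw [← hin, ← hsq, mul_apply_eq_comp]
    nth_rewrite 2 [← hadj]
    rw [ContinuousLinearMap.adjoint_inner_left, inner_self_eq_norm_sq_to_K]
    push_cast
    rfl
  exact_mod_cast h1

theorem norm_evalOp_le [FiniteDimensional ℂ X] {A : X →L[ℂ] X} {C : X →L[ℂ] ℂ}
    (h : A + A.adjoint + C.adjoint ∘L C = 0)
    (hA : ∀ z : ℂ, Module.End.HasEigenvalue (A : X →ₗ[ℂ] X) z → z.re < 0) (b : Blaschke) :
    ‖b.evalOp (-A)‖ ≤ 1 := by
  have hρ : ∀ s : ℂ, 0 ≤ s.re → s ∈ resolventSet ℂ A := fun s => mem_resolventSet_of_stable hA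
  refine ContinuousLinearMap.opNorm_le_bound _ zero_le_one fun x => ?_
  obtain ⟨y, rfl⟩ := exists_aeval_den_eq hρ b x
  rw [evalOp_aeval_den hρ, one_mul]
  exact (norm_num_le_norm_den h b y).1

/-- The kernel of the defect operator of `b(-A)` is the image under the denominator of `b` of the
vectors that are unobservable up to order `deg b`. -/
theorem defectIndex_evalOp [FiniteDimensional ℂ X] {A : X →L[ℂ] X} {C : X →L[ℂ] ℂ}
    (h : A + A.adjoint + C.adjoint ∘L C = 0)
    (hA : ∀ z : ℂ, Module.End.HasEigenvalue (A : X →ₗ[ℂ] X) z → z.re < 0) (b : Blaschke) :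
    defectIndex (b.evalOp (-A)) = min b.deg (Module.finrank ℂ X) := by
  have hρ : ∀ s : ℂ, 0 ≤ s.re → s ∈ resolventSet ℂ A := fun s => mem_resolventSet_of_stable hA
  set E : X →ₗ[ℂ] X := ((Polynomial.aeval (-A) b.den : X →L[ℂ] X) : X →ₗ[ℂ] X) with hE
  have hinj : Function.Injective E :=
    (ContinuousLinearMap.isUnit_iff_bijective.1 (isUnit_aeval_den hρ b)).1
  have hker : LinearMap.ker (defectOp (b.evalOp (-A)) : X →ₗ[ℂ] X) =
      (unobservable (-A) C b.deg).map E := by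
    ext x
    obtain ⟨y, rfl⟩ := exists_aeval_den_eq hρ b x
    have h1 := norm_sq_defectOp (norm_evalOp_le h hA b) (Polynomial.aeval (-A) b.den y)
    rw [evalOp_aeval_den hρ] at h1
    have h2 : (Polynomial.aeval (-A) b.den y ∈ (unobservable (-A) C b.deg).map E) ↔
        y ∈ unobservable (-A) C b.deg := by
      rw [Submodule.mem_map]
      exact ⟨fun ⟨z, hz, hzy⟩ => hinj hzy ▸ hz, fun hy => ⟨y, hy, rfl⟩⟩
    rw [h2, ← (norm_num_le_norm_den h b y).2, LinearMap.mem_ker]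
    change defectOp _ _ = 0 ↔ _
    rw [← norm_eq_zero, ← sq_eq_zero_iff, h1, sub_eq_zero, eq_comm,
      sq_eq_sq₀ (norm_nonneg _) (norm_nonneg _)]
  have h1 := LinearMap.finrank_range_add_finrank_ker (defectOp (b.evalOp (-A)) : X →ₗ[ℂ] X)
  have h2 := finrank_unobservable (eq_zero_of_forall_aeval h hA) b.deg
  rw [hker, ← ((unobservable (-A) C b.deg).equivMapOfInjective E hinj).finrank_eq] at h1
  rw [defectIndex, defectSpace]
  omega

end Defect

theorem LinearMap.exists_linearIsometryEquiv_range {V W₁ W₂ : Type*} [AddCommGroup V] [Module ℂ V]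
    [NormedAddCommGroup W₁] [NormedSpace ℂ W₁] [NormedAddCommGroup W₂] [NormedSpace ℂ W₂]
    (F : V →ₗ[ℂ] W₁) (G : V →ₗ[ℂ] W₂) (h : ∀ x, ‖F x‖ = ‖G x‖) :
    ∃ Ψ : LinearMap.range F ≃ₗᵢ[ℂ] LinearMap.range G, ∀ x (hx : F x ∈ LinearMap.range F),
      (Ψ ⟨F x, hx⟩ : W₂) = G x := by
  have hker : LinearMap.ker F = LinearMap.ker G := by
    ext x
    rw [LinearMap.mem_ker, LinearMap.mem_ker, ← norm_eq_zero, h, norm_eq_zero]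
  let Ψ : LinearMap.range F ≃ₗ[ℂ] LinearMap.range G :=
    F.quotKerEquivRange.symm ≪≫ₗ Submodule.quotEquivOfEq _ _ hker ≪≫ₗ G.quotKerEquivRange
  have hΨ : ∀ x (hx : F x ∈ LinearMap.range F), (Ψ ⟨F x, hx⟩ : W₂) = G x := by
    intro x hx
    simp only [Ψ, LinearEquiv.trans_apply, LinearMap.quotKerEquivRange_symm_apply_image,
      Submodule.mkQ_apply, Submodule.quotEquivOfEq_mk, LinearMap.quotKerEquivRange_apply_mk]
  refine ⟨⟨Ψ, ?_⟩, hΨ⟩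
  rintro ⟨_, x, rfl⟩
  change ‖(Ψ ⟨F x, LinearMap.mem_range_self F x⟩ : W₂)‖ = ‖F x‖
  rw [hΨ, h]

/-! ### The transfer functions as quotients of polynomials -/

section Quotient

variable {X : Type*} [NormedAddCommGroup X] [InnerProductSpace ℂ X]

/-- The divided difference of `p` at `s` and `A`, applied to `z` and then to `C`, is a polynomial
in `s`. -/
theorem exists_polynomial_resolvent_sub (A : X →L[ℂ] X) (C : X →L[ℂ] ℂ) (z : X) (p : ℂ[X]) :
    ∃ P : ℂ[X], ∀ s ∈ resolventSet ℂ A,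
      P.eval s = C (resolvent A s (p.eval s • z - Polynomial.aeval A p z)) := by
  induction p using Polynomial.induction_on with
  | C a => exact ⟨0, fun s _ => by simp [Algebra.algebraMap_eq_smul_one]⟩
  | add p q hp hq =>
    obtain ⟨P, hP⟩ := hp
    obtain ⟨Q, hQ⟩ := hq
    refine ⟨P + Q, fun s hs => ?_⟩
    rw [Polynomial.eval_add, hP s hs, hQ s hs, ← map_add, ← map_add, map_add (Polynomial.aeval A),
      Polynomial.eval_add, add_apply]
    congr 2
    module
  | monomial n a ih =>
    obtain ⟨P, hP⟩ := ih
    set q := Polynomial.C a * Polynomial.X ^ n with hq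
    refine ⟨Polynomial.X * P + Polynomial.C (C (Polynomial.aeval A q z)), fun s hs => ?_⟩
    have h1 : Polynomial.C a * Polynomial.X ^ (n + 1) = Polynomial.X * q := by rw [hq]; ring
    have h2 : (Polynomial.X * q).eval s • z - Polynomial.aeval A (Polynomial.X * q) z =
        s • (q.eval s • z - Polynomial.aeval A q z) +
          (s • Polynomial.aeval A q z - A (Polynomial.aeval A q z)) := by
      rw [Polynomial.eval_mul, Polynomial.eval_X, map_mul, Polynomial.aeval_X, mul_apply_eq_comp]
      module
    rw [h1, h2, map_add, resolvent_apply_sub hs, map_smul, map_add, map_smul, ← hP s hs]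
    simp

/-- Since the characteristic polynomial annihilates `A`, it is a denominator for `C (s - A)⁻¹ z`. -/
theorem exists_polynomial_resolvent [FiniteDimensional ℂ X] (A : X →L[ℂ] X) (C : X →L[ℂ] ℂ)
    (z : X) :
    ∃ P : ℂ[X], ∀ s ∈ resolventSet ℂ A,
      P.eval s = (LinearMap.charpoly (A : X →ₗ[ℂ] X)).eval s * C (resolvent A s z) := by
  obtain ⟨P, hP⟩ := exists_polynomial_resolvent_sub A C z (LinearMap.charpoly (A : X →ₗ[ℂ] X))
  refine ⟨P, fun s hs => ?_⟩
  rw [hP s hs, aeval_charpoly_eq_zero, zero_apply, sub_zero, map_smul, map_smul, smul_eq_mul]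

theorem charpoly_eval_ne_zero [FiniteDimensional ℂ X] {A : X →L[ℂ] X} {s : ℂ}
    (hs : s ∈ resolventSet ℂ A) : (LinearMap.charpoly (A : X →ₗ[ℂ] X)).eval s ≠ 0 := by
  intro h0
  obtain ⟨v, hv⟩ := (Module.End.hasEigenvalue_iff_isRoot_charpoly
    (A : X →ₗ[ℂ] X) s).2 h0 |>.exists_hasEigenvector
  have h1 : A v = s • v := hv.apply_eq_smul
  have h2 := resolvent_apply_sub hs v
  rw [h1, sub_self, map_zero] at h2
  exact hv.2 h2.symm

end Quotient

/-! ### The compression and the defect of `φ̃(-A)` -/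

section Compression

open Blaschke

variable {X : Type*} [NormedAddCommGroup X] [InnerProductSpace ℂ X] [CompleteSpace X]
  [FiniteDimensional ℂ X] {m : Blaschke} {A : X →L[ℂ] X} {B : ℂ →L[ℂ] X} {C : X →L[ℂ] ℂ}
  {D : ℂ →L[ℂ] ℂ}

theorem norm_compression_le (m φ : Blaschke) : ‖compression m φ‖ ≤ 1 :=
  (ContinuousLinearMap.opNorm_comp_le _ _).trans (mul_le_one₀
    (Submodule.orthogonalProjectionOnto_norm_le _) (norm_nonneg m.modelSpace.subtypeL)
    (Submodule.norm_subtypeL_le _))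

/-- The energy balance `‖P Γ x‖² = ‖Γ x‖² - ‖T_φ† Γ x‖² = ‖x‖² - ‖φ̃(-A) x‖²`. -/
theorem norm_orthogonalProjectionOnto_observability (φ : Blaschke)
    (hABCD : IsStableDissipative A B C D) (hm : IsRealization m.toFun A B C D) (x : X) :
    ‖φ.modelSpace.orthogonalProjectionOnto (observability hABCD.lyapunov x)‖ =
      ‖defectOp (φ.tilde.evalOp (-A)) x‖ := by
  rw [← sq_eq_sq₀ (norm_nonneg _) (norm_nonneg _),
    norm_sq_defectOp (norm_evalOp_le hABCD.lyapunov hABCD.stable _),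
    norm_sq_orthogonalProjectionOnto_modelSpace,
    adjoint_multOp_observability hABCD.lyapunov fun s => mem_resolventSet_of_stable hABCD.stable,
    norm_observability hABCD hm, norm_observability hABCD hm]

theorem range_compression (φ : Blaschke) (hABCD : IsStableDissipative A B C D)
    (hm : IsRealization m.toFun A B C D) :
    LinearMap.range (compression m φ : m.modelSpace →ₗ[ℂ] φ.modelSpace) =
      LinearMap.range ((φ.modelSpace.orthogonalProjectionOnto : LTwoPlus →ₗ[ℂ] φ.modelSpace) ∘ₗ
        observability hABCD.lyapunov) := by
  have hrange := range_observability hABCD hm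
  ext g
  constructor
  · rintro ⟨⟨f, hf⟩, rfl⟩
    obtain ⟨x, hx⟩ : f ∈ LinearMap.range (observability hABCD.lyapunov) := hrange ▸ hf
    exact ⟨x, congrArg φ.modelSpace.orthogonalProjectionOnto hx⟩
  · rintro ⟨x, rfl⟩
    exact ⟨⟨observability hABCD.lyapunov x, hrange ▸ LinearMap.mem_range_self _ x⟩, rfl⟩

/-- The unitary operator `Ψ` with `Ψ P Γ = D_{φ̃(-A)}`. -/
theorem exists_isometry_range_compression (φ : Blaschke) (hABCD : IsStableDissipative A B C D)
    (hm : IsRealization m.toFun A B C D) :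
    ∃ Ψ : LinearMap.range (compression m φ : m.modelSpace →ₗ[ℂ] φ.modelSpace) ≃ₗᵢ[ℂ]
          defectSpace (φ.tilde.evalOp (-A)),
        ∀ x : X, ∃ hx : φ.modelSpace.orthogonalProjectionOnto (observability hABCD.lyapunov x) ∈
            LinearMap.range (compression m φ : m.modelSpace →ₗ[ℂ] φ.modelSpace),
          (Ψ ⟨_, hx⟩ : X) = defectOp (φ.tilde.evalOp (-A)) x := by
  rw [range_compression φ hABCD hm]
  obtain ⟨Ψ, hΨ⟩ := LinearMap.exists_linearIsometryEquiv_range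
    ((φ.modelSpace.orthogonalProjectionOnto : LTwoPlus →ₗ[ℂ] φ.modelSpace) ∘ₗ
      observability hABCD.lyapunov)
    (defectOp (φ.tilde.evalOp (-A)) : X →ₗ[ℂ] X)
    (norm_orthogonalProjectionOnto_observability φ hABCD hm)
  exact ⟨Ψ, fun x => ⟨LinearMap.mem_range_self _ x, hΨ x _⟩⟩

/-- If `x` is orthogonal to the defect space, then `Γ x` lies in the range of `T_φ`, and
`Γ x = T_φ T_φ† Γ x = T_φ Γ φ̃(-A) x`. -/
theorem observability_eq_of_mem_orthogonal (φ : Blaschke) (hABCD : IsStableDissipative A B C D)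
    (hm : IsRealization m.toFun A B C D) {x : X}
    (hx : x ∈ (defectSpace (φ.tilde.evalOp (-A)))ᗮ) :
    observability hABCD.lyapunov x =
      φ.multOp (observability hABCD.lyapunov (φ.tilde.evalOp (-A) x)) := by
  have h1 : defectOp (φ.tilde.evalOp (-A)) x = 0 := by
    have hadj : (defectOp (φ.tilde.evalOp (-A))).adjoint = defectOp (φ.tilde.evalOp (-A)) :=
      isSelfAdjoint_defectOp _
    refine ext_inner_left ℂ fun y => ?_
    rw [inner_zero_right, ← hadj, ContinuousLinearMap.adjoint_inner_right]
    exact (Submodule.mem_orthogonal _ _).1 hx _ (LinearMap.mem_range_self _ y)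
  have h2 := norm_orthogonalProjectionOnto_observability φ hABCD hm x
  rw [h1, norm_zero, ← Submodule.norm_coe, norm_eq_zero, orthogonalProjectionOnto_modelSpace,
    sub_eq_zero] at h2
  rwa [adjoint_multOp_observability hABCD.lyapunov fun s =>
    mem_resolventSet_of_stable hABCD.stable] at h2

/-- Both sides of the quotient formula are rational in `s`, so that it extends from the right half
plane to the whole resolvent set. At a pole of `φ` the cross-multiplied identity forces the
denominator `C (s - A)⁻¹ φ̃(-A) x` to vanish, so that these points are excluded. -/
theorem toFun_eq_div_of_mem_orthogonal (φ : Blaschke) (hABCD : IsStableDissipative A B C D)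
    (hm : IsRealization m.toFun A B C D) {x : X}
    (hx : x ∈ (defectSpace (φ.tilde.evalOp (-A)))ᗮ) (hx0 : x ≠ 0) :
    {s ∈ resolventSet ℂ A | C (resolvent A s (φ.tilde.evalOp (-A) x)) = 0}.Finite ∧
      ∀ s ∈ resolventSet ℂ A, C (resolvent A s (φ.tilde.evalOp (-A) x)) ≠ 0 →
        φ.toFun s = C (resolvent A s x) / C (resolvent A s (φ.tilde.evalOp (-A) x)) := by
  have hρ : ∀ s : ℂ, 0 ≤ s.re → s ∈ resolventSet ℂ A := fun s =>
    mem_resolventSet_of_stable hABCD.stable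
  have hΓ := observability_eq_of_mem_orthogonal φ hABCD hm hx
  have hinj := observability_injective hABCD.lyapunov hABCD.stable
  set z := φ.tilde.evalOp (-A) x with hz
  have hz0 : z ≠ 0 := by
    intro h0
    rw [h0, map_zero, map_zero] at hΓ
    exact hx0 (hinj (hΓ.trans (map_zero _).symm))
  have hhalf : ∀ s : ℂ, 0 < s.re → C (resolvent A s x) = φ.toFun s * C (resolvent A s z) := by
    intro s hs
    rw [← inner_expVec_observability hABCD.lyapunov hs (hρ s hs.le), hΓ,
      inner_expVec_multOp _ hs, inner_expVec_observability hABCD.lyapunov hs (hρ s hs.le)]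
  obtain ⟨P, hP⟩ := exists_polynomial_resolvent A C z
  obtain ⟨Q, hQ⟩ := exists_polynomial_resolvent A C x
  have hP0 : P ≠ 0 := by
    rintro rfl
    refine hz0 (hinj (Eq.trans ?_ (map_zero _).symm))
    refine eq_zero_of_inner_expVec one_pos fun s hs => ?_
    have hs : 0 < s.re := hs ▸ one_pos
    have h1 := hP s (hρ s hs.le)
    rw [Polynomial.eval_zero, eq_comm, mul_eq_zero] at h1
    rw [inner_expVec_observability hABCD.lyapunov hs (hρ s hs.le)]
    exact h1.resolve_left (charpoly_eval_ne_zero (hρ s hs.le))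
  have hpoly : φ.den * Q = φ.num * P := by
    refine Polynomial.eq_of_infinite_eval_eq _ _ ((Set.infinite_of_injective_forall_mem
      (f := fun n : ℕ => ((n : ℂ) + 1)) ?_ fun n => ?_))
    · intro a b hab
      simpa using hab
    · have hs : 0 < ((n : ℂ) + 1).re := by
        simp only [Complex.add_re, Complex.natCast_re, Complex.one_re]; positivity
      have hd := φ.den_eval_ne_zero hs.le
      rw [Set.mem_ofPred_eq, Polynomial.eval_mul, Polynomial.eval_mul, hP _ (hρ _ hs.le),
        hQ _ (hρ _ hs.le), hhalf _ hs, toFun_eq]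
      field_simp
  refine ⟨(Polynomial.finite_setOfPred_isRoot hP0).subset fun s hs => ?_, fun s hs hne => ?_⟩
  · rw [Set.mem_ofPred_eq, Polynomial.IsRoot, hP s hs.1, hs.2, mul_zero]
  · have hχ := charpoly_eval_ne_zero hs
    have h1 := congrArg (Polynomial.eval s) hpoly
    rw [Polynomial.eval_mul, Polynomial.eval_mul, hP s hs, hQ s hs] at h1
    have h2 : φ.den.eval s * C (resolvent A s x) = φ.num.eval s * C (resolvent A s z) :=
      mul_left_cancel₀ hχ (by linear_combination h1)
    have hd : φ.den.eval s ≠ 0 := by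
      intro h0
      rw [h0, zero_mul, eq_comm, mul_eq_zero] at h2
      -- the zeros of the numerator lie in the right half plane, where the denominator has none
      have h3 := h2.resolve_right hne
      rcases le_or_gt s.re 0 with hs0 | hs0
      · exact φ.num_eval_ne_zero hs0 h3
      · exact φ.den_eval_ne_zero hs0.le h0
    rw [toFun_eq, div_eq_div_iff hd hne, ← h2, mul_comm]

theorem finrank_range_compression (φ : Blaschke) (hABCD : IsStableDissipative A B C D)
    (hm : IsRealization m.toFun A B C D) :
    Module.finrank ℂ (LinearMap.range (compression m φ : m.modelSpace →ₗ[ℂ] φ.modelSpace)) =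
      min φ.deg m.deg := by
  obtain ⟨Ψ, -⟩ := exists_isometry_range_compression φ hABCD hm
  have h1 := defectIndex_evalOp hABCD.lyapunov hABCD.stable φ.tilde
  rw [finrank_eq_deg hABCD hm] at h1
  exact Ψ.toLinearEquiv.finrank_eq.trans h1

end Compression

theorem lemma4p2 {X : Type*} [NormedAddCommGroup X] [InnerProductSpace ℂ X] [CompleteSpace X]
    [FiniteDimensional ℂ X] (m φ : Blaschke)
    (A : X →L[ℂ] X) (B : ℂ →L[ℂ] X) (C : X →L[ℂ] ℂ) (D : ℂ →L[ℂ] ℂ)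
    (hABCD : IsStableDissipative A B C D) (hm : IsRealization m.toFun A B C D) :
    -- the operators in question are contractions
    (‖compression m φ‖ ≤ 1 ∧ ‖φ.tilde.evalOp (-A)‖ ≤ 1 ∧ ‖φ.evalOp (-A)‖ ≤ 1) ∧
    -- the unitary operator onto the defect space, the defect indices and the rank
    ((∃ Ψ : LinearMap.range (compression m φ : m.modelSpace →ₗ[ℂ] φ.modelSpace) ≃ₗᵢ[ℂ]
          defectSpace (φ.tilde.evalOp (-A)),
        ∀ x : X, ∃ hx : φ.modelSpace.orthogonalProjectionOnto (observability hABCD.lyapunov x) ∈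
            LinearMap.range (compression m φ : m.modelSpace →ₗ[ℂ] φ.modelSpace),
          (Ψ ⟨_, hx⟩ : X) = defectOp (φ.tilde.evalOp (-A)) x) ∧
      defectIndex (φ.tilde.evalOp (-A)) = min φ.deg m.deg ∧
      defectIndex (φ.evalOp (-A)) = min φ.deg m.deg ∧
      LinearMap.rank (compression m φ : m.modelSpace →ₗ[ℂ] φ.modelSpace) =
        ((min φ.deg m.deg : ℕ) : Cardinal)) ∧
    -- when `Y` is onto
    ((φ.deg ≤ m.deg ↔
        LinearMap.range (compression m φ : m.modelSpace →ₗ[ℂ] φ.modelSpace) = ⊤) ∧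
      (φ.deg ≤ m.deg →
        defectIndex (φ.evalOp (-A)) = φ.deg ∧
        defectIndex (φ.tilde.evalOp (-A)) = φ.deg ∧
        Module.rank ℂ (LinearMap.ker (compression m φ : m.modelSpace →ₗ[ℂ] φ.modelSpace)) =
          ((m.deg - φ.deg : ℕ) : Cardinal))) ∧
    -- when `Y` is one to one
    ((Function.Injective (compression m φ) ↔ m.deg ≤ φ.deg) ∧
      (m.deg ≤ φ.deg →
        defectIndex (φ.evalOp (-A)) = m.deg ∧
        defectIndex (φ.tilde.evalOp (-A)) = m.deg ∧
        Module.rank ℂ (LinearMap.ker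
            ((compression m φ).adjoint : φ.modelSpace →ₗ[ℂ] m.modelSpace)) =
          ((φ.deg - m.deg : ℕ) : Cardinal) ∧
        Module.rank ℂ
            (LinearMap.range (compression m φ : m.modelSpace →ₗ[ℂ] φ.modelSpace))ᗮ =
          ((φ.deg - m.deg : ℕ) : Cardinal))) ∧
    -- the quotient formula
    (φ.deg < m.deg →
      (∃ x ∈ (defectSpace (φ.tilde.evalOp (-A)))ᗮ, x ≠ 0) ∧
      ∀ x ∈ (defectSpace (φ.tilde.evalOp (-A)))ᗮ, x ≠ 0 →
        {s ∈ resolventSet ℂ A | C (resolvent A s (φ.tilde.evalOp (-A) x)) = 0}.Finite ∧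
        ∀ s ∈ resolventSet ℂ A, C (resolvent A s (φ.tilde.evalOp (-A) x)) ≠ 0 →
          φ.toFun s =
            C (resolvent A s x) / C (resolvent A s (φ.tilde.evalOp (-A) x))) := by
  have hstable := hABCD.stable
  have hlyap := hABCD.lyapunov
  have hd1 : defectIndex (φ.tilde.evalOp (-A)) = min φ.deg m.deg := by
    rw [defectIndex_evalOp hlyap hstable, finrank_eq_deg hABCD hm]; rfl
  have hd2 : defectIndex (φ.evalOp (-A)) = min φ.deg m.deg := by
    rw [defectIndex_evalOp hlyap hstable, finrank_eq_deg hABCD hm]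
  have hr := finrank_range_compression φ hABCD hm
  set Y : m.modelSpace →ₗ[ℂ] φ.modelSpace := (compression m φ : m.modelSpace →ₗ[ℂ] φ.modelSpace)
    with hY
  have hk := LinearMap.finrank_range_add_finrank_ker Y
  rw [hr, m.finrank_modelSpace] at hk
  have ho := Submodule.finrank_add_finrank_orthogonal (LinearMap.range Y)
  rw [hr, φ.finrank_modelSpace] at ho
  have hka : LinearMap.ker ((compression m φ).adjoint : φ.modelSpace →ₗ[ℂ] m.modelSpace) =
      (LinearMap.range Y)ᗮ := ((compression m φ).orthogonal_range).symm
  refine ⟨⟨norm_compression_le m φ, norm_evalOp_le hlyap hstable _, norm_evalOp_le hlyap hstable _⟩,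
    ⟨exists_isometry_range_compression φ hABCD hm, hd1, hd2, ?_⟩, ⟨?_, fun hle => ⟨?_, ?_, ?_⟩⟩,
    ⟨?_, fun hle => ⟨?_, ?_, ?_, ?_⟩⟩, fun hlt => ⟨?_, fun x hx hx0 =>
      toFun_eq_div_of_mem_orthogonal φ hABCD hm hx hx0⟩⟩
  · rw [LinearMap.rank, ← Module.finrank_eq_rank, hr]
  · refine ⟨fun hle => Submodule.eq_top_of_finrank_eq ?_, fun htop => ?_⟩
    · rw [hr, φ.finrank_modelSpace, min_eq_left hle]
    · rw [htop, finrank_top, φ.finrank_modelSpace] at hr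
      omega
  · omega
  · omega
  · rw [← Module.finrank_eq_rank, show Module.finrank ℂ (LinearMap.ker Y) = m.deg - φ.deg by omega]
  · change Function.Injective Y ↔ _
    rw [← LinearMap.ker_eq_bot, ← Submodule.finrank_eq_zero]
    omega
  · omega
  · omega
  · rw [hka, ← Module.finrank_eq_rank,
      show Module.finrank ℂ (LinearMap.range Y)ᗮ = φ.deg - m.deg by omega]
  · rw [← Module.finrank_eq_rank,
      show Module.finrank ℂ (LinearMap.range Y)ᗮ = φ.deg - m.deg by omega]
  · have h1 := Submodule.finrank_add_finrank_orthogonal (defectSpace (φ.tilde.evalOp (-A)))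
    rw [show Module.finrank ℂ (defectSpace (φ.tilde.evalOp (-A))) = min φ.deg m.deg from hd1,
      finrank_eq_deg hABCD hm] at h1
    exact Submodule.exists_mem_ne_zero_of_ne_bot fun h0 => by
      rw [h0, finrank_bot] at h1
      omega
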